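/- Let $k$ be a field. A monomial algebra is $kQ/\langle Z\rangle$ with $Q$ a finite quiver and $Z$ a finite set of paths of length at least $2$, none a proper subpath of another; paths are composed from right to left, $\mathcal B$ is the basis of paths containing no element of $Z$ as a subpath, and $k(X/\!/\mathcal B)$ is the vector space with basis the pairs $x/\!/p$ with $x\in X$, $p\in\mathcal B$ parallel. For an arrow $a$ and a path $\gamma$ parallel to $a$, let $r^{a/\!/\gamma}$ be the sum of all paths in $\mathcal B$ obtained from the path $r$ by replacing one appearance of $a$ by $\gamma$. Put $$\delta^0\colon k(Q_0/\!/\mathcal B)\to k(Q_1/\!/\mathcal B),\quad \delta^0(e/\!/p)=\sum_{s(a)=e,\ ap\in\mathcal B}a/\!/ap-\sum_{t(a)=e,\ pa\in\mathcal B}a/\!/pa,$$ $$\delta^1\colon k(Q_1/\!/\mathcal B)\to k(Z/\!/\mathcal B),\quad \delta^1(a/\!/p)=\sum_{r\in Z}r/\!/r^{a/\!/p}.$$ $\operatorname{Ker}\delta^1$ is a Lie algebra under $[a/\!/\gamma,b/\!/\varepsilon]=b/\!/\varepsilon^{a/\!/\gamma}-a/\!/\gamma^{b/\!/\varepsilon}$;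 an element $x=\sum\lambda_{a/\!/p}\,a/\!/p$ of it corresponds to the derivation that vanishes on the vertices and sends each arrow $a$ to $\sum_p\lambda_{a/\!/p}\,p$. Let $\mathrm{HH}^1$ denote the Lie algebra of derivations modulo inner derivations. Let $A=kQ_A/\langle Z_A\rangle$ and $B=kQ_B/\langle Z_B\rangle$ be directed monomial algebras on the same vertices $1,\dots,n$, i.e. every arrow $i\to j$ of $Q_A$ or $Q_B$ satisfies $i<j$, and assume that the two endpoints of each arrow of $Q_A$ lie in the same connected component of $Q_B$ (for example, that $B$ is connected). Let $\Lambda=\Lambda(B,A^{\mathrm{op}})$ be the dual extension algebra: the monomial algebra on the same vertices whose arrows are those of $Q_B$ and of $Q_{A^{\mathrm{op}}}$ (disjoint union) and whose relations are those of $B$, those of $A^{\mathrm{op}}$ and all paths $\alpha\beta$ (first $\beta$, then $\alpha$) with $\alpha$ an arrow of $Q_B$ and $\beta$ an arrow of $Q_{A^{\mathrm{op}}}$. Let - $\mathcal J'$ be the set of elements of $\operatorname{Ker}\delta^1_\Lambda$ in the span of the $b/\!/p$ with $b$ an arrow of $Q_B$ and $p\in\mathcal B_\Lambda$ of the form $q_m\cdots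 q_1p_l\cdots p_1$ with $l,m\ge1$, $p_i$ arrows of $Q_B$ and $q_j$ arrows of $Q_{A^{\mathrm{op}}}$; - $\operatorname{Ker}\delta^1_{\Lambda|B}$ be the set of elements of $\operatorname{Ker}\delta^1_\Lambda$ that vanish on the arrows of $Q_B$, and $\mathcal J=\mathcal J'+\operatorname{Ker}\delta^1_{\Lambda|B}$; - $\mathcal I$ be the part of $\operatorname{Im}\delta^0_\Lambda$ of degree at least $2$, where $a/\!/p$ has degree the length of $p$. Then the sum $\mathcal J=\mathcal J'\oplus\operatorname{Ker}\delta^1_{\Lambda|B}$ is direct, $\mathcal J$ is a Lie ideal of $\operatorname{Ker}\delta^1_\Lambda$, $\mathcal I$ is contained in $\mathcal J$ and is a Lie ideal of it, and there is a short exact sequence of Lie algebras $$0\to\mathcal J/\mathcal I\to\mathrm{HH}^1(\Lambda)\to\mathrm{HH}^1(B)\to0,$$ in which the first map is induced by the inclusion $\mathcal J\subseteq\operatorname{Ker}\delta^1_\Lambda$ and the second by the projection $\operatorname{Ker}\delta^1_\Lambda\to\operatorname{Ker}\delta^1_B$ that keeps the terms $b/\!/p$ with $b$ an arrow and $p$ a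 path of $Q_B$ and drops all others. -/

import Mathlib

noncomputable section

open scoped Classical

universe u

/-! ### Quivers and paths -/

/-- A finite quiver with vertex set `Fin n`. -/
structure FinQuiver (n : ℕ) where
  Arr : Type u
  fintypeArr : Fintype Arr
  src : Arr → Fin n
  tgt : Arr → Fin n

attribute [instance] FinQuiver.fintypeArr

namespace FinQuiver

variable {n : ℕ}

/-- `Q.IsPath i l j`: the arrows in the list `l`, traversed from left to right, form a path
from `i` to `j`. -/
def IsPath (Q : FinQuiver.{u} n) : Fin n → List Q.Arr → Fin n → Prop
  | i, [], j => i = j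
  | i, a :: l, j => Q.src a = i ∧ Q.IsPath (Q.tgt a) l j

/-- Paths of a quiver, including the trivial ones. The arrows are listed in the order in which
they are traversed. -/
@[ext]
structure Path (Q : FinQuiver.{u} n) where
  source : Fin n
  target : Fin n
  arrows : List Q.Arr
  isPath : Q.IsPath source arrows target

/-- The trivial path at a vertex. -/
def Path.vertex (Q : FinQuiver.{u} n) (i : Fin n) : Q.Path := ⟨i, i, [], rfl⟩

/-- An arrow, as a path of length one. -/
def Path.arrow (Q : FinQuiver.{u} n) (a : Q.Arr) : Q.Path := ⟨Q.src a, Q.tgt a, [a], rfl, rfl⟩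

theorem isPath_append (Q : FinQuiver.{u} n) {l l' : List Q.Arr} {i j : Fin n} :
    Q.IsPath i (l ++ l') j ↔ ∃ m, Q.IsPath i l m ∧ Q.IsPath m l' j := by
  induction l generalizing i with
  | nil => simp [IsPath]
  | cons a l ih => simp [IsPath, ih, and_assoc]

theorem IsPath.target_unique {Q : FinQuiver.{u} n} {l : List Q.Arr} {i j j' : Fin n}
    (h : Q.IsPath i l j) (h' : Q.IsPath i l j') : j = j' := by
  induction l generalizing i with
  | nil => exact h.symm.trans h'
  | cons a l ih => exact ih h.2 h'.2

/-- Two vertices are linked if they lie in the same connected component of (the underlying graph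
of) the quiver. -/
def Linked (Q : FinQuiver.{u} n) : Fin n → Fin n → Prop :=
  Relation.EqvGen fun i j => ∃ a : Q.Arr, Q.src a = i ∧ Q.tgt a = j

/-- The quiver is numbered so that every arrow `i → j` satisfies `i < j`. -/
def IsDirected (Q : FinQuiver.{u} n) : Prop := ∀ a : Q.Arr, Q.src a < Q.tgt a

/-- The opposite quiver. -/
abbrev op (Q : FinQuiver.{u} n) : FinQuiver.{u} n where
  Arr := Q.Arr
  fintypeArr := Q.fintypeArr
  src := Q.tgt
  tgt := Q.src

theorem IsPath.op {Q : FinQuiver.{u} n} {l : List Q.Arr} {i j : Fin n} (h : Q.IsPath i l j) :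
    Q.op.IsPath j l.reverse i := by
  induction l generalizing i with
  | nil => exact h.symm
  | cons a l ih =>
    rw [List.reverse_cons]
    exact (isPath_append _).2 ⟨Q.tgt a, ih h.2, rfl, h.1⟩

/-- The reversed path, in the opposite quiver. -/
def Path.op {Q : FinQuiver.{u} n} (p : Q.Path) : Q.op.Path :=
  ⟨p.target, p.source, p.arrows.reverse, p.isPath.op⟩

/-- The quiver whose arrows are the disjoint union of the arrows of `Q` and of `R`. -/
abbrev union (Q R : FinQuiver.{u} n) : FinQuiver.{u} n where
  Arr := Q.Arr ⊕ R.Arr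
  fintypeArr := inferInstance
  src := Sum.elim Q.src R.src
  tgt := Sum.elim Q.tgt R.tgt

theorem IsPath.inl {Q : FinQuiver.{u} n} (R : FinQuiver.{u} n) {l : List Q.Arr} {i j : Fin n}
    (h : Q.IsPath i l j) : (Q.union R).IsPath i (l.map Sum.inl) j := by
  induction l generalizing i with
  | nil => exact h
  | cons a l ih => exact ⟨h.1, ih h.2⟩

theorem IsPath.inr {R : FinQuiver.{u} n} (Q : FinQuiver.{u} n) {l : List R.Arr} {i j : Fin n}
    (h : R.IsPath i l j) : (Q.union R).IsPath i (l.map Sum.inr) j := by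
  induction l generalizing i with
  | nil => exact h
  | cons a l ih => exact ⟨h.1, ih h.2⟩

/-- A path of `Q`, viewed in the union. -/
def Path.inl {Q : FinQuiver.{u} n} (R : FinQuiver.{u} n) (p : Q.Path) : (Q.union R).Path :=
  ⟨p.source, p.target, p.arrows.map Sum.inl, p.isPath.inl R⟩

/-- A path of `R`, viewed in the union. -/
def Path.inr {R : FinQuiver.{u} n} (Q : FinQuiver.{u} n) (p : R.Path) : (Q.union R).Path :=
  ⟨p.source, p.target, p.arrows.map Sum.inr, p.isPath.inr Q⟩

end FinQuiver

/-- A finite quiver together with a finite set `rel` of paths of length at least two, none of which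
is a proper subpath of another one. These data present the monomial algebra `kQ / ⟨rel⟩`. -/
structure MonomialQuiver (n : ℕ) extends FinQuiver.{u} n where
  rel : Set toFinQuiver.Path
  rel_finite : rel.Finite
  two_le_length : ∀ r ∈ rel, 2 ≤ r.arrows.length
  rel_minimal : ∀ r ∈ rel, ∀ s ∈ rel, r.arrows <:+: s.arrows → r = s

/-! ### The path algebra -/

section PathAlgebra

variable {n : ℕ} (k : Type*) [Field k] (Q : FinQuiver.{u} n)

/-- The path algebra `kQ`, as a vector space: it has the paths as a basis. -/
def PathAlg : Type _ := Q.Path →₀ k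

namespace PathAlg

instance : AddCommGroup (PathAlg k Q) := inferInstanceAs (AddCommGroup (Q.Path →₀ k))
instance : Module k (PathAlg k Q) := inferInstanceAs (Module k (Q.Path →₀ k))

variable {Q}

/-- A path as an element of the path algebra. -/
def of (p : Q.Path) : PathAlg k Q := Finsupp.single p (1 : k)

variable {k}

/-- The linear extension of a function on paths. -/
def lift {M : Type*} [AddCommGroup M] [Module k M] (f : Q.Path → M) : PathAlg k Q →ₗ[k] M :=
  Finsupp.linearCombination k f

theorem lift_of {M : Type*} [AddCommGroup M] [Module k M] (f : Q.Path → M) (p : Q.Path) :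
    lift f (of k p) = f p := by
  have h := Finsupp.linearCombination_single (R := k) (v := f) 1 p
  rw [one_smul] at h
  exact h

/-- Induction on the basis of paths. -/
theorem induction_paths {P : PathAlg k Q → Prop} (h0 : P 0)
    (hadd : ∀ x y, P x → P y → P (x + y)) (hsmul : ∀ (c : k) x, P x → P (c • x))
    (hof : ∀ p, P (of k p)) (x : PathAlg k Q) : P x := by
  refine Finsupp.induction_linear (motive := fun x : Q.Path →₀ k => P x) x h0 hadd ?_
  intro p c
  have h : (Finsupp.single p c : Q.Path →₀ k) = c • Finsupp.single p (1 : k) := by simp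
  rw [h]
  exact hsmul c _ (hof p)

variable (k Q)

/-- The list of arrows `l` as a path from `i` to `j`, and `0` if it is not such a path. -/
def pathOrZero (i : Fin n) (l : List Q.Arr) (j : Fin n) : PathAlg k Q :=
  if h : Q.IsPath i l j then of k ⟨i, j, l, h⟩ else 0

variable {Q}

/-- The product `p q` of two paths: first `q`, then `p`, and `0` if they cannot be composed. -/
def mulPath (p q : Q.Path) : PathAlg k Q :=
  if q.target = p.source then pathOrZero k Q q.source (q.arrows ++ p.arrows) p.target else 0

variable (Q)

/-- The bilinear extension of the product of paths. -/
def mulHom : PathAlg k Q →ₗ[k] PathAlg k Q →ₗ[k] PathAlg k Q :=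
  lift fun p => lift fun q => mulPath k p q

instance : Mul (PathAlg k Q) := ⟨fun x y => mulHom k Q x y⟩
instance : One (PathAlg k Q) := ⟨∑ i, of k (FinQuiver.Path.vertex Q i)⟩

variable {k Q}

theorem mul_def (x y : PathAlg k Q) : x * y = mulHom k Q x y := rfl

theorem one_def : (1 : PathAlg k Q) = ∑ i, of k (FinQuiver.Path.vertex Q i) := rfl

theorem of_mul_of (p q : Q.Path) : of k p * of k q = mulPath k p q := by
  rw [mul_def, mulHom, lift_of, lift_of]

theorem pathOrZero_of_isPath {i j : Fin n} {l : List Q.Arr} (h : Q.IsPath i l j) :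
    pathOrZero k Q i l j = of k (⟨i, j, l, h⟩ : Q.Path) := dif_pos h

theorem of_mul_of_comp {i j m : Fin n} {l l' : List Q.Arr} (h : Q.IsPath i l m)
    (h' : Q.IsPath m l' j) :
    of k (⟨m, j, l', h'⟩ : Q.Path) * of k (⟨i, m, l, h⟩ : Q.Path) =
      of k (⟨i, j, l ++ l', Q.isPath_append.2 ⟨m, h, h'⟩⟩ : Q.Path) := by
  rw [of_mul_of, mulPath, if_pos rfl, pathOrZero_of_isPath]

theorem of_mul_of_ne {p q : Q.Path} (h : q.target ≠ p.source) : of k p * of k q = 0 := by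
  rw [of_mul_of, mulPath, if_neg h]

theorem add_mul' (x y z : PathAlg k Q) : (x + y) * z = x * z + y * z := by
  simp only [mul_def, map_add, LinearMap.add_apply]
theorem mul_add' (x y z : PathAlg k Q) : x * (y + z) = x * y + x * z := by
  simp only [mul_def, map_add]
theorem zero_mul' (x : PathAlg k Q) : 0 * x = 0 := by
  simp only [mul_def, map_zero, LinearMap.zero_apply]
theorem mul_zero' (x : PathAlg k Q) : x * 0 = 0 := by
  simp only [mul_def, map_zero]
theorem smul_mul' (c : k) (x y : PathAlg k Q) : c • x * y = c • (x * y) := by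
  simp only [mul_def, map_smul, LinearMap.smul_apply]
theorem mul_smul' (c : k) (x y : PathAlg k Q) : x * c • y = c • (x * y) := by
  simp only [mul_def, map_smul]

theorem of_assoc (p q r : Q.Path) :
    of k p * of k q * of k r = of k p * (of k q * of k r) := by
  obtain ⟨i, j, l, h⟩ := p
  obtain ⟨i', j', l', h'⟩ := q
  obtain ⟨i'', j'', l'', h''⟩ := r
  by_cases h1 : j' = i <;> by_cases h2 : j'' = i'
  · subst h1 h2
    simp only [of_mul_of_comp, List.append_assoc]
  · subst h1
    rw [of_mul_of_comp, of_mul_of_ne h2, of_mul_of_ne h2, mul_zero']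
  · subst h2
    rw [of_mul_of_comp, of_mul_of_ne h1, of_mul_of_ne h1, zero_mul']
  · rw [of_mul_of_ne h1, of_mul_of_ne h2, mul_zero', zero_mul']

theorem one_mul' (x : PathAlg k Q) : 1 * x = x := by
  refine induction_paths (P := fun x => 1 * x = x) (mul_zero' _)
    (fun x y hx hy => by rw [mul_add', hx, hy]) (fun c x hx => by rw [mul_smul', hx])
    (fun p => ?_) x
  have h : (1 : PathAlg k Q) * of k p =
      ∑ i, of k (FinQuiver.Path.vertex Q i) * of k p := by
    simp only [mul_def, one_def, map_sum, LinearMap.sum_apply]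
  rw [h, Finset.sum_eq_single p.target]
  · obtain ⟨i, j, l, hp⟩ := p
    have := of_mul_of_comp (k := k) hp (show Q.IsPath j [] j from rfl)
    simp only [List.append_nil] at this
    exact this
  · intro i _ hi
    exact of_mul_of_ne (Ne.symm hi)
  · simp

theorem mul_one' (x : PathAlg k Q) : x * 1 = x := by
  refine induction_paths (P := fun x => x * 1 = x) (zero_mul' _)
    (fun x y hx hy => by rw [add_mul', hx, hy]) (fun c x hx => by rw [smul_mul', hx])
    (fun p => ?_) x
  have h : of k p * (1 : PathAlg k Q) =
      ∑ i, of k p * of k (FinQuiver.Path.vertex Q i) := by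
    simp only [mul_def, one_def, map_sum]
  rw [h, Finset.sum_eq_single p.source]
  · obtain ⟨i, j, l, hp⟩ := p
    exact of_mul_of_comp (k := k) (show Q.IsPath i [] i from rfl) hp
  · intro i _ hi
    exact of_mul_of_ne hi
  · simp

theorem mul_assoc' (x y z : PathAlg k Q) : x * y * z = x * (y * z) := by
  refine induction_paths (P := fun x => x * y * z = x * (y * z)) (by simp only [zero_mul'])
    (fun a b ha hb => by simp only [add_mul', ha, hb])
    (fun c a ha => by simp only [smul_mul', ha]) (fun p => ?_) x
  refine induction_paths (P := fun y => of k p * y * z = of k p * (y * z))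
    (by simp only [zero_mul', mul_zero'])
    (fun a b ha hb => by simp only [add_mul', mul_add', ha, hb])
    (fun c a ha => by simp only [smul_mul', mul_smul', ha]) (fun q => ?_) y
  refine induction_paths (P := fun z => of k p * of k q * z = of k p * (of k q * z))
    (by simp only [mul_zero'])
    (fun a b ha hb => by simp only [mul_add', ha, hb])
    (fun c a ha => by simp only [mul_smul', ha]) (fun r => ?_) z
  exact of_assoc p q r

instance : Ring (PathAlg k Q) :=
  { (inferInstance : AddCommGroup (PathAlg k Q)) with
    mul := (· * ·)
    one := 1
    mul_assoc := mul_assoc'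
    one_mul := one_mul'
    mul_one := mul_one'
    left_distrib := mul_add'
    right_distrib := add_mul'
    zero_mul := zero_mul'
    mul_zero := mul_zero' }

instance : Algebra k (PathAlg k Q) := Algebra.ofModule smul_mul' mul_smul'

end PathAlg

end PathAlgebra

/-! ### The first Hochschild cohomology of an algebra -/

section Hochschild

variable (k : Type*) [Field k] (A : Type*) [Ring A] [Algebra k A]

/-- The space of `k`-linear derivations of `A`. -/
def algDer : Submodule k (A →ₗ[k] A) where
  carrier := {D | ∀ x y, D (x * y) = D x * y + x * D y}
  add_mem' := by
    intro D E hD hE x y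
    simp only [LinearMap.add_apply, hD x y, hE x y, add_mul, mul_add]
    abel
  zero_mem' := by intro x y; simp
  smul_mem' := by
    intro c D hD x y
    simp only [LinearMap.smul_apply, hD x y, smul_add, smul_mul_assoc, mul_smul_comm]

variable {k A}

theorem algDer_leibniz (D : algDer k A) (x y : A) :
    D.1 (x * y) = D.1 x * y + x * D.1 y := D.2 x y

theorem algDer_commutator (D E : algDer k A) :
    D.1 ∘ₗ E.1 - E.1 ∘ₗ D.1 ∈ algDer k A := by
  intro x y
  simp only [LinearMap.sub_apply, LinearMap.comp_apply, algDer_leibniz, map_add]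
  noncomm_ring

/-- The commutator bracket on derivations. -/
instance : Bracket (algDer k A) (algDer k A) := ⟨fun D E => ⟨_, algDer_commutator D E⟩⟩

theorem algDer_lie_apply (D E : algDer k A) (x : A) :
    (⁅D, E⁆ : algDer k A).1 x = D.1 (E.1 x) - E.1 (D.1 x) := rfl

theorem algDer_ext {D E : algDer k A} (h : ∀ x, D.1 x = E.1 x) : D = E :=
  Subtype.ext (LinearMap.ext h)

theorem algDer_add_apply (D E : algDer k A) (x : A) : (D + E).1 x = D.1 x + E.1 x := rfl

theorem algDer_smul_apply (c : k) (D : algDer k A) (x : A) : (c • D).1 x = c • D.1 x := rfl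

instance : LieRing (algDer k A) where
  add_lie D E F := algDer_ext fun x => by
    simp only [algDer_lie_apply, algDer_add_apply, map_add]; abel
  lie_add D E F := algDer_ext fun x => by
    simp only [algDer_lie_apply, algDer_add_apply, map_add]; abel
  lie_self D := algDer_ext fun x => by
    simp only [algDer_lie_apply, sub_self]; rfl
  leibniz_lie D E F := algDer_ext fun x => by
    simp only [algDer_lie_apply, algDer_add_apply, map_sub]; abel

instance : LieAlgebra k (algDer k A) where
  lie_smul c D E := algDer_ext fun x => by
    simp only [algDer_lie_apply, algDer_smul_apply, map_smul, smul_sub]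

variable (k A)

/-- The Lie ideal of inner derivations `x ↦ c x - x c`. -/
def innDer : LieIdeal k (algDer k A) where
  carrier := {D | ∃ c : A, ∀ x, D.1 x = c * x - x * c}
  add_mem' := by
    rintro D E ⟨c, hc⟩ ⟨d, hd⟩
    refine ⟨c + d, fun x => ?_⟩
    rw [algDer_add_apply, hc, hd]; noncomm_ring
  zero_mem' := ⟨0, fun x => by simp⟩
  smul_mem' := by
    rintro r D ⟨c, hc⟩
    refine ⟨r • c, fun x => ?_⟩
    rw [algDer_smul_apply, hc, smul_sub, smul_mul_assoc, mul_smul_comm]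
  lie_mem := by
    rintro D E ⟨c, hc⟩
    refine ⟨D.1 c, fun x => ?_⟩
    rw [algDer_lie_apply, hc, hc, map_sub, algDer_leibniz, algDer_leibniz]; noncomm_ring

/-- The first Hochschild cohomology `HH¹(A)`, as a Lie algebra: 1-cocycles of the Hochschild complex
are derivations, 1-coboundaries are inner derivations, and the Gerstenhaber bracket is the
commutator. -/
abbrev HH1 : Type _ := algDer k A ⧸ innDer k A

end Hochschild

/-! ### Monomial algebras and the combinatorial complex -/

namespace MonomialQuiver

variable {n : ℕ} (k : Type*) [Field k] (Q : MonomialQuiver.{u} n)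

/-- The ideal of the path algebra generated by the relations. -/
def relIdeal : TwoSidedIdeal (PathAlg k Q.toFinQuiver) :=
  TwoSidedIdeal.span (PathAlg.of k '' Q.rel)

/-- The monomial algebra `kQ / ⟨rel⟩`. -/
abbrev Alg : Type _ := PathAlg k Q.toFinQuiver ⧸ (Q.relIdeal k).asIdeal

/-- The class of a path in the monomial algebra. -/
def cls (p : Q.Path) : Q.Alg k := Ideal.Quotient.mk _ (PathAlg.of k p)

variable {Q} in
/-- The path belongs to `ℬ`: it does not contain any relation as a subpath. -/
def IsBasic (p : Q.Path) : Prop := ∀ r ∈ Q.rel, ¬ r.arrows <:+: p.arrows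

/-- The space `k(Q₀//ℬ)`. -/
def C0 : Submodule k (Fin n × Q.Path →₀ k) :=
  Finsupp.supported k k {ep | IsBasic ep.2 ∧ ep.2.source = ep.1 ∧ ep.2.target = ep.1}

/-- The space `k(Q₁//ℬ)`; the pair `(a, p)` stands for `a//p`. -/
def C1 : Submodule k (Q.Arr × Q.Path →₀ k) :=
  Finsupp.supported k k
    {ap | IsBasic ap.2 ∧ ap.2.source = Q.src ap.1 ∧ ap.2.target = Q.tgt ap.1}

/-- The linear projection that keeps the paths in `ℬ` and kills all others. -/
def trunc : PathAlg k Q.toFinQuiver →ₗ[k] PathAlg k Q.toFinQuiver :=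
  PathAlg.lift fun p => if IsBasic p then PathAlg.of k p else 0

/-- The sum of all paths obtained from `r` by replacing one appearance of the arrow `a` by the
path `γ`. -/
def replaceAll (r : Q.Path) (a : Q.Arr) (γ : Q.Path) : PathAlg k Q.toFinQuiver :=
  ∑ i ∈ Finset.range r.arrows.length,
    if r.arrows[i]? = some a then
      PathAlg.pathOrZero k Q.toFinQuiver r.source
        (r.arrows.take i ++ γ.arrows ++ r.arrows.drop (i + 1)) r.target
    else 0

/-- The element `r^{a//γ}`: the sum of all paths in `ℬ` obtained from `r` by replacing one
appearance of the arrow `a` by the path `γ`. -/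
def replace (r : Q.Path) (a : Q.Arr) (γ : Q.Path) : PathAlg k Q.toFinQuiver :=
  Q.trunc k (Q.replaceAll k r a γ)

/-- For `x = ∑ λ_p p`, the element `t//x = ∑ λ_p t//p`. -/
def pair {T : Type*} (t : T) : PathAlg k Q.toFinQuiver →ₗ[k] (T × Q.Path →₀ k) :=
  PathAlg.lift fun p => Finsupp.single (t, p) 1

/-- The differential `δ⁰`, with
`δ⁰(e//p) = ∑_{s(a) = e, ap ∈ ℬ} a//ap - ∑_{t(a) = e, pa ∈ ℬ} a//pa`. -/
def delta0 : (Fin n × Q.Path →₀ k) →ₗ[k] (Q.Arr × Q.Path →₀ k) :=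
  Finsupp.linearCombination k fun ep =>
    (∑ a : Q.Arr, if Q.src a = ep.1 then
        Q.pair k a (Q.trunc k
          (PathAlg.pathOrZero k Q.toFinQuiver ep.2.source (ep.2.arrows ++ [a]) (Q.tgt a)))
      else 0) -
    ∑ a : Q.Arr, if Q.tgt a = ep.1 then
        Q.pair k a (Q.trunc k
          (PathAlg.pathOrZero k Q.toFinQuiver (Q.src a) (a :: ep.2.arrows) ep.2.target))
      else 0

/-- The differential `δ¹`, with `δ¹(a//p) = ∑_{r ∈ rel} r//r^{a//p}`. -/
def delta1 : (Q.Arr × Q.Path →₀ k) →ₗ[k] (Q.Path × Q.Path →₀ k) :=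
  Finsupp.linearCombination k fun ap =>
    ∑ r ∈ Q.rel_finite.toFinset, Q.pair k r (Q.replace k r ap.1 ap.2)

/-- `Im δ⁰`. -/
def imDelta0 : Submodule k (Q.Arr × Q.Path →₀ k) := (Q.C0 k).map (Q.delta0 k)

/-- `Ker δ¹`. -/
def kerDelta1 : Submodule k (Q.Arr × Q.Path →₀ k) := Q.C1 k ⊓ LinearMap.ker (Q.delta1 k)

/-- The bilinear bracket with `[a//γ, b//ε] = b//ε^{a//γ} - a//γ^{b//ε}`. -/
def br : (Q.Arr × Q.Path →₀ k) →ₗ[k] (Q.Arr × Q.Path →₀ k) →ₗ[k] (Q.Arr × Q.Path →₀ k) :=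
  Finsupp.linearCombination k fun aγ => Finsupp.linearCombination k fun bε =>
    Q.pair k bε.1 (Q.replace k bε.2 aγ.1 aγ.2) - Q.pair k aγ.1 (Q.replace k aγ.2 bε.1 bε.2)

/-- For `x = ∑ λ_{a//p} a//p`, the value `x(a) = ∑_p λ_{a//p} p`. -/
def val {T : Type*} (t : T) : (T × Q.Path →₀ k) →ₗ[k] PathAlg k Q.toFinQuiver :=
  Finsupp.linearCombination k fun bp => if bp.1 = t then PathAlg.of k bp.2 else 0

/-! ### The Lie algebra structure on `Ker δ¹` -/

/-- The linear endomorphism of the path algebra that replaces arrows `a` by `x(a)`. -/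
def subst : (Q.Arr × Q.Path →₀ k) →ₗ[k]
    PathAlg k Q.toFinQuiver →ₗ[k] PathAlg k Q.toFinQuiver :=
  Finsupp.linearCombination k fun aγ => PathAlg.lift fun r => Q.replaceAll k r aγ.1 aγ.2

variable {k Q}

theorem trunc_of (p : Q.Path) :
    Q.trunc k (PathAlg.of k p) = if IsBasic p then PathAlg.of k p else 0 := by
  rw [trunc, PathAlg.lift_of]

theorem pair_of {T : Type*} (t : T) (p : Q.Path) :
    Q.pair k t (PathAlg.of k p) = Finsupp.single (t, p) 1 := by
  rw [pair, PathAlg.lift_of]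

theorem val_single {T : Type*} (t u : T) (p : Q.Path) :
    Q.val k t (Finsupp.single (u, p) 1) = if u = t then PathAlg.of k p else 0 := by
  rw [val, Finsupp.linearCombination_single, one_smul]

theorem val_pair {T : Type*} (t u : T) (f : PathAlg k Q.toFinQuiver) :
    Q.val k t (Q.pair k u f) = if u = t then f else 0 := by
  refine PathAlg.induction_paths (P := fun f => Q.val k t (Q.pair k u f) = if u = t then f else 0)
    (by simp) (fun x y hx hy => ?_) (fun c x hx => ?_) (fun p => ?_) f
  · rw [map_add, map_add, hx, hy]; split_ifs <;> simp
  · rw [map_smul, map_smul, hx]; split_ifs <;> simp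
  · rw [pair_of, val_single]

theorem sum_pair_val (x : Q.Arr × Q.Path →₀ k) : ∑ a, Q.pair k a (Q.val k a x) = x := by
  induction x using Finsupp.induction_linear with
  | zero => simp
  | add x y hx hy => simp only [map_add, Finset.sum_add_distrib, hx, hy]
  | single bp c =>
    have h : (Finsupp.single bp c : Q.Arr × Q.Path →₀ k) = c • Finsupp.single (bp.1, bp.2) 1 := by
      simp
    rw [h]
    simp only [map_smul, ← Finset.smul_sum, val_single]
    rw [Finset.sum_eq_single bp.1]
    · simp [pair_of]
    · intro b _ hb
      rw [if_neg (Ne.symm hb), map_zero]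
    · simp

theorem val_ext {x y : Q.Arr × Q.Path →₀ k} (h : ∀ a, Q.val k a x = Q.val k a y) : x = y := by
  rw [← sum_pair_val x, ← sum_pair_val y]
  simp only [h]

/-- Bilinear extensionality on pairs. -/
theorem pairs_induction {P : (Q.Arr × Q.Path →₀ k) → Prop} (h0 : P 0)
    (hadd : ∀ x y, P x → P y → P (x + y)) (hsmul : ∀ (c : k) x, P x → P (c • x))
    (hs : ∀ a p, P (Finsupp.single (a, p) 1)) (x : Q.Arr × Q.Path →₀ k) : P x := by
  induction x using Finsupp.induction_linear with
  | zero => exact h0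
  | add x y hx hy => exact hadd x y hx hy
  | single bp c =>
    have h : (Finsupp.single bp c : Q.Arr × Q.Path →₀ k) = c • Finsupp.single (bp.1, bp.2) 1 := by
      simp
    rw [h]
    exact hsmul c _ (hs _ _)

theorem C1_induction {P : (Q.Arr × Q.Path →₀ k) → Prop} (h0 : P 0)
    (hadd : ∀ x y, P x → P y → P (x + y)) (hsmul : ∀ (c : k) x, P x → P (c • x))
    (hs : ∀ a p, IsBasic p → p.source = Q.src a → p.target = Q.tgt a →
      P (Finsupp.single (a, p) 1)) {x : Q.Arr × Q.Path →₀ k} (hx : x ∈ Q.C1 k) : P x := by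
  rw [C1, Finsupp.supported_eq_span_single] at hx
  refine Submodule.span_induction (p := fun x _ => P x) ?_ h0 (fun x y _ _ => hadd x y)
    (fun c x _ => hsmul c x) hx
  rintro _ ⟨⟨a, p⟩, ⟨h1, h2, h3⟩, rfl⟩
  exact hs a p h1 h2 h3

theorem subst_single_of (a : Q.Arr) (γ r : Q.Path) :
    Q.subst k (Finsupp.single (a, γ) 1) (PathAlg.of k r) = Q.replaceAll k r a γ := by
  rw [subst, Finsupp.linearCombination_single, one_smul, PathAlg.lift_of]

theorem br_single (a b : Q.Arr) (γ ε : Q.Path) :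
    Q.br k (Finsupp.single (a, γ) 1) (Finsupp.single (b, ε) 1) =
      Q.pair k b (Q.replace k ε a γ) - Q.pair k a (Q.replace k γ b ε) := by
  rw [br, Finsupp.linearCombination_single, one_smul, Finsupp.linearCombination_single, one_smul]

theorem val_br (c : Q.Arr) (x y : Q.Arr × Q.Path →₀ k) :
    Q.val k c (Q.br k x y) =
      Q.trunc k (Q.subst k x (Q.val k c y)) - Q.trunc k (Q.subst k y (Q.val k c x)) := by
  refine pairs_induction (P := fun x => Q.val k c (Q.br k x y) =
      Q.trunc k (Q.subst k x (Q.val k c y)) - Q.trunc k (Q.subst k y (Q.val k c x)))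
    (by simp) (fun x x' hx hx' => ?_) (fun r x hx => ?_) (fun a γ => ?_) x
  · simp only [map_add, LinearMap.add_apply, hx, hx']; abel
  · simp only [map_smul, LinearMap.smul_apply, hx, smul_sub]
  refine pairs_induction (P := fun y => Q.val k c (Q.br k (Finsupp.single (a, γ) 1) y) =
      Q.trunc k (Q.subst k (Finsupp.single (a, γ) 1) (Q.val k c y)) -
        Q.trunc k (Q.subst k y (Q.val k c (Finsupp.single (a, γ) 1))))
    (by simp) (fun x x' hx hx' => ?_) (fun r x hx => ?_) (fun b ε => ?_) y
  · simp only [map_add, LinearMap.add_apply, hx, hx']; abel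
  · simp only [map_smul, LinearMap.smul_apply, hx, smul_sub]
  rw [br_single, map_sub, val_pair, val_pair, val_single, val_single]
  congr 1 <;> split_ifs <;> simp only [subst_single_of, map_zero, replace]

theorem val_delta1 {r : Q.Path} (hr : r ∈ Q.rel) (x : Q.Arr × Q.Path →₀ k) :
    Q.val k r (Q.delta1 k x) = Q.trunc k (Q.subst k x (PathAlg.of k r)) := by
  refine pairs_induction (P := fun x => Q.val k r (Q.delta1 k x) =
      Q.trunc k (Q.subst k x (PathAlg.of k r)))
    (by simp) (fun x x' hx hx' => ?_) (fun r x hx => ?_) (fun a γ => ?_) x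
  · simp only [map_add, LinearMap.add_apply, hx, hx']
  · simp only [map_smul, LinearMap.smul_apply, hx]
  rw [delta1, Finsupp.linearCombination_single, one_smul, map_sum, subst_single_of]
  simp only [val_pair]
  rw [Finset.sum_ite_eq', if_pos (by simpa using hr), replace]

theorem trunc_trunc (f : PathAlg k Q.toFinQuiver) : Q.trunc k (Q.trunc k f) = Q.trunc k f := by
  refine PathAlg.induction_paths (P := fun f => Q.trunc k (Q.trunc k f) = Q.trunc k f)
    (by simp) (fun x y hx hy => by simp only [map_add, hx, hy])
    (fun c x hx => by simp only [map_smul, hx]) (fun p => ?_) f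
  rw [trunc_of]; split_ifs with h
  · rw [trunc_of, if_pos h]
  · rw [map_zero]

theorem trunc_mul_left (f g : PathAlg k Q.toFinQuiver) :
    Q.trunc k (Q.trunc k f * g) = Q.trunc k (f * g) := by
  refine PathAlg.induction_paths (P := fun f => Q.trunc k (Q.trunc k f * g) = Q.trunc k (f * g))
    (by simp) (fun x y hx hy => by simp only [map_add, add_mul, hx, hy])
    (fun c x hx => by simp only [map_smul, smul_mul_assoc, hx]) (fun p => ?_) f
  refine PathAlg.induction_paths
    (P := fun g => Q.trunc k (Q.trunc k (PathAlg.of k p) * g) = Q.trunc k (PathAlg.of k p * g))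
    (by simp) (fun x y hx hy => by simp only [map_add, mul_add, hx, hy])
    (fun c x hx => by simp only [map_smul, mul_smul_comm, hx]) (fun q => ?_) g
  rw [trunc_of]
  split_ifs with h
  · rfl
  · obtain ⟨i, j, l, hp⟩ := p
    obtain ⟨i', j', l', hq⟩ := q
    rw [zero_mul, map_zero]
    by_cases h1 : j' = i
    · subst h1
      rw [PathAlg.of_mul_of_comp, trunc_of, if_neg]
      intro hb
      refine h fun r hr hrl => hb r hr (hrl.trans ?_)
      exact (List.suffix_append _ _).isInfix
    · rw [PathAlg.of_mul_of_ne h1, map_zero]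

theorem trunc_mul_right (f g : PathAlg k Q.toFinQuiver) :
    Q.trunc k (f * Q.trunc k g) = Q.trunc k (f * g) := by
  refine PathAlg.induction_paths (P := fun f => Q.trunc k (f * Q.trunc k g) = Q.trunc k (f * g))
    (by simp) (fun x y hx hy => by simp only [map_add, add_mul, hx, hy])
    (fun c x hx => by simp only [map_smul, smul_mul_assoc, hx]) (fun p => ?_) f
  refine PathAlg.induction_paths
    (P := fun g => Q.trunc k (PathAlg.of k p * Q.trunc k g) = Q.trunc k (PathAlg.of k p * g))
    (by simp) (fun x y hx hy => by simp only [map_add, mul_add, hx, hy])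
    (fun c x hx => by simp only [map_smul, mul_smul_comm, hx]) (fun q => ?_) g
  rw [trunc_of]
  split_ifs with h
  · rfl
  · obtain ⟨i, j, l, hp⟩ := p
    obtain ⟨i', j', l', hq⟩ := q
    rw [mul_zero, map_zero]
    by_cases h1 : j' = i
    · subst h1
      rw [PathAlg.of_mul_of_comp, trunc_of, if_neg]
      intro hb
      refine h fun r hr hrl => hb r hr (hrl.trans ?_)
      exact (List.prefix_append _ _).isInfix
    · rw [PathAlg.of_mul_of_ne h1, map_zero]

theorem isPath_replace {Q : FinQuiver.{u} n} {s t : Fin n} {l γ : List Q.Arr} {a : Q.Arr} {i : ℕ}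
    (hl : Q.IsPath s l t) (hγ : Q.IsPath (Q.src a) γ (Q.tgt a)) (ha : l[i]? = some a) :
    Q.IsPath s (l.take i ++ γ ++ l.drop (i + 1)) t := by
  induction l generalizing s i with
  | nil => simp at ha
  | cons b l ih =>
    cases i with
    | zero =>
      simp only [List.getElem?_cons_zero, Option.some.injEq] at ha
      subst ha
      obtain ⟨rfl, h2⟩ := hl
      exact Q.isPath_append.2 ⟨_, Q.isPath_append.2 ⟨_, rfl, hγ⟩, h2⟩
    | succ i =>
      exact ⟨hl.1, ih hl.2 ha⟩

theorem pathOrZero_mul_of {i m m' j : Fin n} {l l' : List Q.Arr} (h : Q.IsPath i l m)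
    (h' : Q.IsPath m' l' j) :
    PathAlg.pathOrZero k Q.toFinQuiver m' l' j * PathAlg.of k ⟨i, m, l, h⟩ =
      if m = m' then PathAlg.pathOrZero k Q.toFinQuiver i (l ++ l') j else 0 := by
  rw [PathAlg.pathOrZero_of_isPath h']
  split_ifs with hm
  · subst hm
    rw [PathAlg.of_mul_of_comp, PathAlg.pathOrZero_of_isPath]
  · exact PathAlg.of_mul_of_ne hm

theorem of_mul_pathOrZero {i m m' j : Fin n} {l l' : List Q.Arr} (h : Q.IsPath i l m)
    (h' : Q.IsPath m' l' j) :
    PathAlg.of k ⟨m', j, l', h'⟩ * PathAlg.pathOrZero k Q.toFinQuiver i l m =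
      if m = m' then PathAlg.pathOrZero k Q.toFinQuiver i (l ++ l') j else 0 := by
  rw [PathAlg.pathOrZero_of_isPath h]
  split_ifs with hm
  · subst hm
    rw [PathAlg.of_mul_of_comp, PathAlg.pathOrZero_of_isPath]
  · exact PathAlg.of_mul_of_ne hm

theorem replaceAll_mul (p q : Q.Path) (a : Q.Arr) (γ : Q.Path) (h1 : γ.source = Q.src a)
    (h2 : γ.target = Q.tgt a) :
    Q.subst k (Finsupp.single (a, γ) 1) (PathAlg.of k p * PathAlg.of k q) =
      Q.replaceAll k p a γ * PathAlg.of k q + PathAlg.of k p * Q.replaceAll k q a γ := by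
  have hγ : Q.IsPath (Q.src a) γ.arrows (Q.tgt a) := by rw [← h1, ← h2]; exact γ.isPath
  obtain ⟨i, j, l, hp⟩ := p
  obtain ⟨i', j', l', hq⟩ := q
  have e1 : Q.replaceAll k ⟨i, j, l, hp⟩ a γ * PathAlg.of k ⟨i', j', l', hq⟩ =
      ∑ x ∈ Finset.range l.length, if l[x]? = some a then
        (if j' = i then PathAlg.pathOrZero k Q.toFinQuiver i'
          (l' ++ (l.take x ++ γ.arrows ++ l.drop (x + 1))) j else 0) else 0 := by
    rw [replaceAll, Finset.sum_mul]
    refine Finset.sum_congr rfl fun x _ => ?_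
    by_cases ha : l[x]? = some a
    · rw [if_pos ha, if_pos ha, pathOrZero_mul_of hq (isPath_replace hp hγ ha)]
    · rw [if_neg ha, if_neg ha, zero_mul]
  have e2 : PathAlg.of k ⟨i, j, l, hp⟩ * Q.replaceAll k ⟨i', j', l', hq⟩ a γ =
      ∑ x ∈ Finset.range l'.length, if l'[x]? = some a then
        (if j' = i then PathAlg.pathOrZero k Q.toFinQuiver i'
          ((l'.take x ++ γ.arrows ++ l'.drop (x + 1)) ++ l) j else 0) else 0 := by
    rw [replaceAll, Finset.mul_sum]
    refine Finset.sum_congr rfl fun x _ => ?_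
    by_cases ha : l'[x]? = some a
    · rw [if_pos ha, if_pos ha, of_mul_pathOrZero (isPath_replace hq hγ ha) hp]
    · rw [if_neg ha, if_neg ha, mul_zero]
  rw [e1, e2]
  by_cases hm : j' = i
  · subst hm
    rw [PathAlg.of_mul_of_comp, subst_single_of, replaceAll]
    simp only [if_true, List.length_append]
    rw [Finset.sum_range_add, add_comm]
    refine congrArg₂ (· + ·) (Finset.sum_congr rfl fun x _ => ?_)
      (Finset.sum_congr rfl fun x hx => ?_)
    · rw [List.getElem?_append_right (by omega), Nat.add_sub_cancel_left]
      congr 2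
      rw [List.take_append, List.drop_append, List.take_of_length_le (by omega),
        List.drop_eq_nil_of_le (by omega)]
      simp [Nat.add_assoc]
    · have hx' : x < l'.length := Finset.mem_range.1 hx
      rw [List.getElem?_append_left hx']
      congr 2
      rw [List.take_append_of_le_length hx'.le, List.drop_append_of_le_length hx']
      simp
  · rw [PathAlg.of_mul_of_ne hm]
    simp [hm]

theorem subst_mul {x : Q.Arr × Q.Path →₀ k} (hx : x ∈ Q.C1 k)
    (f g : PathAlg k Q.toFinQuiver) :
    Q.subst k x (f * g) = Q.subst k x f * g + f * Q.subst k x g := by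
  refine C1_induction (P := fun x => Q.subst k x (f * g) = Q.subst k x f * g + f * Q.subst k x g)
    (by simp) (fun x y hx hy => ?_) (fun c x hx => ?_) (fun a γ _ h1 h2 => ?_) hx
  · simp only [map_add, LinearMap.add_apply, hx, hy, add_mul, mul_add]; abel
  · simp only [map_smul, LinearMap.smul_apply, hx, smul_add, smul_mul_assoc, mul_smul_comm]
  refine PathAlg.induction_paths (P := fun f => Q.subst k (Finsupp.single (a, γ) 1) (f * g) =
      Q.subst k (Finsupp.single (a, γ) 1) f * g + f * Q.subst k (Finsupp.single (a, γ) 1) g)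
    (by simp) (fun x y hx hy => ?_) (fun c x hx => ?_) (fun p => ?_) f
  · simp only [map_add, hx, hy, add_mul]; abel
  · simp only [map_smul, hx, smul_add, smul_mul_assoc]
  refine PathAlg.induction_paths (P := fun g => Q.subst k (Finsupp.single (a, γ) 1)
      (PathAlg.of k p * g) = Q.subst k (Finsupp.single (a, γ) 1) (PathAlg.of k p) * g +
        PathAlg.of k p * Q.subst k (Finsupp.single (a, γ) 1) g)
    (by simp) (fun x y hx hy => ?_) (fun c x hx => ?_) (fun q => ?_) g
  · simp only [map_add, hx, hy, mul_add]; abel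
  · simp only [map_smul, hx, smul_add, mul_smul_comm]
  rw [subst_single_of, subst_single_of, replaceAll_mul _ _ _ _ h1 h2]

theorem subst_vertex (x : Q.Arr × Q.Path →₀ k) (p : Q.Path) (hp : p.arrows = []) :
    Q.subst k x (PathAlg.of k p) = 0 := by
  refine pairs_induction (P := fun x => Q.subst k x (PathAlg.of k p) = 0)
    (by simp) (fun x y hx hy => ?_) (fun c x hx => ?_) (fun a γ => ?_) x
  · rw [map_add, LinearMap.add_apply, hx, hy, add_zero]
  · rw [map_smul, LinearMap.smul_apply, hx, smul_zero]
  · rw [subst_single_of, replaceAll, hp]; rfl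

theorem subst_arrow {x : Q.Arr × Q.Path →₀ k} (hx : x ∈ Q.C1 k) (a : Q.Arr) :
    Q.subst k x (PathAlg.of k (FinQuiver.Path.arrow Q.toFinQuiver a)) = Q.val k a x := by
  refine C1_induction (P := fun x => Q.subst k x
      (PathAlg.of k (FinQuiver.Path.arrow Q.toFinQuiver a)) = Q.val k a x)
    (by simp) (fun x y hx hy => ?_) (fun c x hx => ?_) (fun b γ _ h1 h2 => ?_) hx
  · rw [map_add, LinearMap.add_apply, hx, hy, map_add]
  · rw [map_smul, LinearMap.smul_apply, hx, map_smul]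
  · rw [subst_single_of, replaceAll, val_single]
    simp only [FinQuiver.Path.arrow, List.length_singleton, Finset.range_one,
      Finset.sum_singleton, List.getElem?_cons_zero, Option.some.injEq, List.take_zero,
      List.nil_append, zero_add, List.drop_one, List.tail_cons, List.append_nil]
    by_cases hb : a = b
    · subst hb
      obtain ⟨i, j, l, hγ⟩ := γ
      subst h1 h2
      rw [if_pos rfl, if_pos rfl, PathAlg.pathOrZero_of_isPath hγ]
    · rw [if_neg hb, if_neg (Ne.symm hb)]

theorem trunc_subst_rel {x : Q.Arr × Q.Path →₀ k} (hx : x ∈ Q.kerDelta1 k) {r : Q.Path}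
    (hr : r ∈ Q.rel) : Q.trunc k (Q.subst k x (PathAlg.of k r)) = 0 := by
  rw [← val_delta1 hr, LinearMap.mem_ker.1 hx.2, map_zero]

theorem trunc_subst_trunc {x : Q.Arr × Q.Path →₀ k} (hx : x ∈ Q.kerDelta1 k)
    (f : PathAlg k Q.toFinQuiver) :
    Q.trunc k (Q.subst k x (Q.trunc k f)) = Q.trunc k (Q.subst k x f) := by
  refine PathAlg.induction_paths (P := fun f =>
      Q.trunc k (Q.subst k x (Q.trunc k f)) = Q.trunc k (Q.subst k x f))
    (by simp) (fun x y hx hy => by simp only [map_add, hx, hy])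
    (fun c x hx => by simp only [map_smul, hx]) (fun p => ?_) f
  rw [trunc_of]
  split_ifs with hp
  · rfl
  rw [map_zero, map_zero]
  simp only [IsBasic, not_forall, not_not] at hp
  obtain ⟨r, hr, u, v, huv⟩ := hp
  obtain ⟨i, j, l, hl⟩ := p
  obtain ⟨i', j', l', hl'⟩ := r
  simp only at huv
  subst huv
  obtain ⟨m', h12, h3⟩ := Q.isPath_append.1 hl
  obtain ⟨m, h1, h2⟩ := Q.isPath_append.1 h12
  have hne : l' ≠ [] := by
    have := Q.two_le_length _ hr
    rintro rfl
    simp at this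
  obtain ⟨a, l'', rfl⟩ := List.exists_cons_of_ne_nil hne
  obtain rfl : i' = m := hl'.1.symm.trans h2.1
  obtain rfl : j' = m' := hl'.target_unique h2
  have e : (PathAlg.of k ⟨i, j, u ++ (a :: l'') ++ v, hl⟩ : PathAlg k Q.toFinQuiver) =
      PathAlg.of k ⟨j', j, v, h3⟩ * (PathAlg.of k ⟨i', j', a :: l'', hl'⟩ *
        PathAlg.of k ⟨i, i', u, h1⟩) := by
    rw [PathAlg.of_mul_of_comp, PathAlg.of_mul_of_comp]
  have t0 : Q.trunc k (PathAlg.of k ⟨i', j', a :: l'', hl'⟩) = 0 := by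
    rw [trunc_of, if_neg]
    exact fun hb => hb _ hr List.infix_rfl
  have t1 := trunc_subst_rel hx hr
  rw [e, subst_mul hx.1, subst_mul hx.1, mul_add, map_add, map_add]
  have z1 : ∀ f g : PathAlg k Q.toFinQuiver,
      Q.trunc k (f * (PathAlg.of k ⟨i', j', a :: l'', hl'⟩ * g)) = 0 := by
    intro f g
    rw [← trunc_mul_right, ← trunc_mul_left (PathAlg.of k _), t0, zero_mul, map_zero, mul_zero,
      map_zero]
  have z2 : ∀ f g : PathAlg k Q.toFinQuiver,
      Q.trunc k (f * (Q.subst k x (PathAlg.of k ⟨i', j', a :: l'', hl'⟩) * g)) = 0 := by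
    intro f g
    rw [← trunc_mul_right, ← trunc_mul_left (Q.subst k x _), t1, zero_mul, map_zero, mul_zero,
      map_zero]
  rw [z1, z1, z2, add_zero, add_zero]

theorem pair_replace_mem (a : Q.Arr) (γ : Q.Path) {b : Q.Arr} {ε : Q.Path}
    (h1 : ε.source = Q.src b) (h2 : ε.target = Q.tgt b) :
    Q.pair k b (Q.replace k ε a γ) ∈ Q.C1 k := by
  rw [replace, replaceAll, map_sum, map_sum]
  refine Submodule.sum_mem _ fun i _ => ?_
  split_ifs
  · rw [PathAlg.pathOrZero]
    split_ifs
    · rw [trunc_of]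
      split_ifs with hb
      · rw [pair_of]
        exact Finsupp.single_mem_supported k 1 ⟨hb, h1, h2⟩
      · simp
    · simp
  · simp

theorem br_mem_C1 {x y : Q.Arr × Q.Path →₀ k} (hx : x ∈ Q.C1 k) (hy : y ∈ Q.C1 k) :
    Q.br k x y ∈ Q.C1 k := by
  refine C1_induction (P := fun x => Q.br k x y ∈ Q.C1 k)
    (by simp) (fun x y hx hy => ?_) (fun c x hx => ?_) (fun a γ _ h1 h2 => ?_) hx
  · rw [map_add]; exact Submodule.add_mem _ hx hy
  · rw [map_smul]; exact Submodule.smul_mem _ _ hx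
  refine C1_induction (P := fun y => Q.br k (Finsupp.single (a, γ) 1) y ∈ Q.C1 k)
    (by simp) (fun x y hx hy => ?_) (fun c x hx => ?_) (fun b ε _ h3 h4 => ?_) hy
  · rw [map_add]; exact Submodule.add_mem _ hx hy
  · rw [map_smul]; exact Submodule.smul_mem _ _ hx
  rw [br_single]
  exact Submodule.sub_mem _ (pair_replace_mem _ _ h3 h4) (pair_replace_mem _ _ h1 h2)

theorem trunc_subst_br {x y : Q.Arr × Q.Path →₀ k} (hx : x ∈ Q.kerDelta1 k)
    (hy : y ∈ Q.kerDelta1 k) (f : PathAlg k Q.toFinQuiver) :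
    Q.trunc k (Q.subst k (Q.br k x y) f) =
      Q.trunc k (Q.subst k x (Q.subst k y f)) - Q.trunc k (Q.subst k y (Q.subst k x f)) := by
  refine PathAlg.induction_paths (P := fun f => Q.trunc k (Q.subst k (Q.br k x y) f) =
      Q.trunc k (Q.subst k x (Q.subst k y f)) - Q.trunc k (Q.subst k y (Q.subst k x f)))
    (by simp) (fun x y hx hy => ?_) (fun c x hx => ?_) (fun p => ?_) f
  · simp only [map_add, hx, hy]; abel
  · simp only [map_smul, hx, smul_sub]
  have key : ∀ (l : List Q.Arr) (i j : Fin n) (h : Q.IsPath i l j),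
      Q.trunc k (Q.subst k (Q.br k x y) (PathAlg.of k ⟨i, j, l, h⟩)) =
      Q.trunc k (Q.subst k x (Q.subst k y (PathAlg.of k ⟨i, j, l, h⟩))) -
        Q.trunc k (Q.subst k y (Q.subst k x (PathAlg.of k ⟨i, j, l, h⟩))) := by
    intro l
    induction l with
    | nil =>
      intro i j h
      have hz : ∀ z : Q.Arr × Q.Path →₀ k, Q.subst k z (PathAlg.of k ⟨i, j, [], h⟩) = 0 :=
        fun z => subst_vertex z _ rfl
      simp only [hz, map_zero, sub_zero]
    | cons a l ih =>
      intro i j hal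
      obtain ⟨rfl, h⟩ := id hal
      have e : (PathAlg.of k ⟨Q.src a, j, a :: l, hal⟩ : PathAlg k Q.toFinQuiver) =
          PathAlg.of k ⟨Q.tgt a, j, l, h⟩ *
            PathAlg.of k (FinQuiver.Path.arrow Q.toFinQuiver a) := by
        exact (PathAlg.of_mul_of_comp (k := k) (Q := Q.toFinQuiver) (i := Q.src a) (l := [a])
          (FinQuiver.Path.arrow Q.toFinQuiver a).isPath h).symm
      have ha : Q.trunc k (Q.subst k (Q.br k x y)
          (PathAlg.of k (FinQuiver.Path.arrow Q.toFinQuiver a))) =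
          Q.trunc k (Q.subst k x (Q.subst k y
            (PathAlg.of k (FinQuiver.Path.arrow Q.toFinQuiver a)))) -
          Q.trunc k (Q.subst k y (Q.subst k x
            (PathAlg.of k (FinQuiver.Path.arrow Q.toFinQuiver a)))) := by
        rw [subst_arrow (br_mem_C1 hx.1 hy.1), subst_arrow hx.1, subst_arrow hy.1, val_br,
          map_sub, trunc_trunc, trunc_trunc]
      have hl := ih (Q.tgt a) j h
      rw [e]
      generalize PathAlg.of k ⟨Q.tgt a, j, l, h⟩ = f at hl
      generalize PathAlg.of k (FinQuiver.Path.arrow Q.toFinQuiver a) = g at ha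
      simp only [subst_mul (br_mem_C1 hx.1 hy.1), subst_mul hx.1, subst_mul hy.1, map_add]
      rw [← trunc_mul_left (Q.subst k (Q.br k x y) f), hl,
        ← trunc_mul_right _ (Q.subst k (Q.br k x y) g), ha]
      rw [sub_mul, mul_sub, map_sub, map_sub]
      simp only [trunc_mul_left, trunc_mul_right]
      abel
  exact key p.arrows p.source p.target p.isPath

theorem br_mem {x y : Q.Arr × Q.Path →₀ k} (hx : x ∈ Q.kerDelta1 k) (hy : y ∈ Q.kerDelta1 k) :
    Q.br k x y ∈ Q.kerDelta1 k := by
  refine ⟨br_mem_C1 hx.1 hy.1, ?_⟩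
  have h : ∀ z : Q.Arr × Q.Path →₀ k, Q.delta1 k z =
      ∑ r ∈ Q.rel_finite.toFinset, Q.pair k r (Q.trunc k (Q.subst k z (PathAlg.of k r))) := by
    intro z
    refine pairs_induction (P := fun z => Q.delta1 k z =
        ∑ r ∈ Q.rel_finite.toFinset, Q.pair k r (Q.trunc k (Q.subst k z (PathAlg.of k r))))
      (by simp) (fun x x' hx hx' => ?_) (fun r x hx => ?_) (fun a γ => ?_) z
    · simp only [map_add, LinearMap.add_apply, hx, hx', Finset.sum_add_distrib]
    · simp only [map_smul, LinearMap.smul_apply, hx, Finset.smul_sum]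
    · rw [delta1, Finsupp.linearCombination_single, one_smul]
      simp only [subst_single_of, replace]
  refine LinearMap.mem_ker.2 ?_
  rw [h]
  refine Finset.sum_eq_zero fun r hr => ?_
  have hr' : r ∈ Q.rel := by simpa using hr
  rw [trunc_subst_br hx hy, ← trunc_subst_trunc hx, ← trunc_subst_trunc hy (Q.subst k x _),
    trunc_subst_rel hx hr', trunc_subst_rel hy hr']
  simp

/-- The bracket on `Ker δ¹`. -/
instance : Bracket (Q.kerDelta1 k) (Q.kerDelta1 k) :=
  ⟨fun x y => ⟨Q.br k x.1 y.1, br_mem x.2 y.2⟩⟩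

theorem coe_lie (x y : Q.kerDelta1 k) : (⁅x, y⁆ : Q.kerDelta1 k).1 = Q.br k x.1 y.1 := rfl

instance : LieRing (Q.kerDelta1 k) where
  add_lie x y z := Subtype.ext <| by
    simp only [coe_lie, Submodule.coe_add, map_add, LinearMap.add_apply]
  lie_add x y z := Subtype.ext <| by
    simp only [coe_lie, Submodule.coe_add, map_add]
  lie_self x := Subtype.ext <| val_ext fun a => by
    rw [coe_lie, val_br, sub_self]; exact (map_zero _).symm
  leibniz_lie x y z := Subtype.ext <| val_ext fun a => by
    simp only [coe_lie, Submodule.coe_add, map_add, val_br, map_sub, trunc_subst_trunc x.2,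
      trunc_subst_trunc y.2, trunc_subst_trunc z.2, trunc_subst_br x.2 y.2,
      trunc_subst_br x.2 z.2, trunc_subst_br y.2 z.2]
    abel

instance : LieAlgebra k (Q.kerDelta1 k) where
  lie_smul c x y := Subtype.ext <| by
    simp only [coe_lie, Submodule.coe_smul, map_smul]

variable (k)

/-- The derivation `D` of the monomial algebra corresponds to `x = ∑ λ_{a//p} a//p`: it vanishes
on the vertices, and `D(a) = ∑_p λ_{a//p} p` for every arrow `a`. -/
def Represents (x : Q.Arr × Q.Path →₀ k) (D : algDer k (Q.Alg k)) : Prop :=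
  (∀ i, D.1 (Q.cls k (FinQuiver.Path.vertex Q.toFinQuiver i)) = 0) ∧
    ∀ a, D.1 (Q.cls k (FinQuiver.Path.arrow Q.toFinQuiver a)) =
      Ideal.Quotient.mk _ (Q.val k a x)

/-! ### Dual extensions -/

/-- The presentation of the opposite of a monomial algebra. -/
def op (A : MonomialQuiver.{u} n) : MonomialQuiver.{u} n where
  toFinQuiver := A.toFinQuiver.op
  rel := FinQuiver.Path.op '' A.rel
  rel_finite := A.rel_finite.image _
  two_le_length := by
    rintro _ ⟨r, hr, rfl⟩
    simpa [FinQuiver.Path.op] using A.two_le_length r hr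
  rel_minimal := by
    rintro _ ⟨r, hr, rfl⟩ _ ⟨s, hs, rfl⟩ h
    rw [A.rel_minimal r hr s hs (List.reverse_infix.1 h)]

/-- The path `αβ` (first `β`, then `α`), for an arrow `α` of `Q` and an arrow `β` of `R`. -/
def mixedRel (Q R : FinQuiver.{u} n) (α : Q.Arr) (β : R.Arr) (h : R.tgt β = Q.src α) :
    (Q.union R).Path :=
  ⟨R.src β, Q.tgt α, [Sum.inr β, Sum.inl α], rfl, h.symm, rfl⟩

theorem mixedRel_finite (Q R : FinQuiver.{u} n) :
    {p | ∃ α β h, p = mixedRel Q R α β h}.Finite := by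
  refine (Set.finite_range (fun x : {x : Q.Arr × R.Arr // R.tgt x.2 = Q.src x.1} =>
    mixedRel Q R x.1.1 x.1.2 x.2)).subset ?_
  rintro _ ⟨α, β, h, rfl⟩
  exact ⟨⟨(α, β), h⟩, rfl⟩

theorem inl_injective (Q R : FinQuiver.{u} n) :
    Function.Injective (FinQuiver.Path.inl R : Q.Path → (Q.union R).Path) := by
  intro p q h
  have h1 := congrArg FinQuiver.Path.source h
  have h2 := congrArg FinQuiver.Path.target h
  have h3 := congrArg FinQuiver.Path.arrows h
  exact FinQuiver.Path.ext h1 h2 (List.map_injective_iff.2 Sum.inl_injective h3)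

theorem map_infix_map {α β : Type*} {f : α → β} (hf : Function.Injective f) {l l' : List α}
    (h : l.map f <:+: l'.map f) : l <:+: l' := by
  obtain ⟨s, t, hst⟩ := h
  obtain ⟨u, v, rfl, hu, rfl⟩ := List.map_eq_append_iff.1 hst.symm
  obtain ⟨u, w, rfl, rfl, hw⟩ := List.map_eq_append_iff.1 hu
  rw [List.map_injective_iff.2 hf hw]
  exact ⟨u, v, rfl⟩

/-- The dual extension `Λ(B, Aᵒᵖ)`: its arrows are those of `B` and of `Aᵒᵖ`, and its relations are
those of `B`, those of `Aᵒᵖ`, and all paths `αβ` (first `β`, then `α`) with `α` an arrow of `B` and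
`β` an arrow of `Aᵒᵖ`. -/
def dualExt (B A : MonomialQuiver.{u} n) : MonomialQuiver.{u} n where
  toFinQuiver := B.toFinQuiver.union A.op.toFinQuiver
  rel := FinQuiver.Path.inl A.op.toFinQuiver '' B.rel ∪
    FinQuiver.Path.inr B.toFinQuiver '' A.op.rel ∪
    {p | ∃ α β h, p = mixedRel B.toFinQuiver A.op.toFinQuiver α β h}
  rel_finite := ((B.rel_finite.image _).union (A.op.rel_finite.image _)).union
    (mixedRel_finite _ _)
  two_le_length := by
    rintro _ ((⟨r, hr, rfl⟩ | ⟨r, hr, rfl⟩) | ⟨α, β, h, rfl⟩)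
    · simpa [FinQuiver.Path.inl] using B.two_le_length r hr
    · simpa [FinQuiver.Path.inr] using A.op.two_le_length r hr
    · exact le_rfl
  rel_minimal := by
    rintro _ ((⟨r, hr, rfl⟩ | ⟨r, hr, rfl⟩) | ⟨α, β, h, rfl⟩) _
      ((⟨s, hs, rfl⟩ | ⟨s, hs, rfl⟩) | ⟨α', β', h', rfl⟩) hrs
    · rw [B.rel_minimal r hr s hs (map_infix_map Sum.inl_injective hrs)]
    · exfalso
      have h2 := B.two_le_length r hr
      obtain ⟨a, l, hl⟩ := List.exists_cons_of_length_pos (by omega : 0 < r.arrows.length)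
      have := hrs.subset (show Sum.inl a ∈ (FinQuiver.Path.inl _ r).arrows by
        simp [FinQuiver.Path.inl, hl])
      simp [FinQuiver.Path.inr] at this
    · exfalso
      have h2 := B.two_le_length r hr
      have e := hrs.eq_of_length_le (by simpa [FinQuiver.Path.inl, mixedRel] using h2)
      have : Sum.inr β' ∈ (FinQuiver.Path.inl A.op.toFinQuiver r).arrows := by
        rw [e]; simp [mixedRel]
      simp [FinQuiver.Path.inl] at this
    · exfalso
      have h2 := A.op.two_le_length r hr
      obtain ⟨a, l, hl⟩ := List.exists_cons_of_length_pos (by omega : 0 < r.arrows.length)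
      have := hrs.subset (show Sum.inr a ∈ (FinQuiver.Path.inr _ r).arrows by
        simp [FinQuiver.Path.inr, hl])
      simp [FinQuiver.Path.inl] at this
    · rw [A.op.rel_minimal r hr s hs (map_infix_map Sum.inr_injective hrs)]
    · exfalso
      have h2 := A.op.two_le_length r hr
      have e := hrs.eq_of_length_le (by simpa [FinQuiver.Path.inr, mixedRel] using h2)
      have : Sum.inl α' ∈ (FinQuiver.Path.inr B.toFinQuiver r).arrows := by
        rw [e]; simp [mixedRel]
      simp [FinQuiver.Path.inr] at this
    · exfalso
      have := hrs.subset (show Sum.inr β ∈ (mixedRel _ _ α β h).arrows by simp [mixedRel])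
      simp [FinQuiver.Path.inl] at this
    · exfalso
      have := hrs.subset (show Sum.inl α ∈ (mixedRel _ _ α β h).arrows by simp [mixedRel])
      simp [FinQuiver.Path.inr] at this
    · have e := hrs.eq_of_length rfl
      simp only [mixedRel, List.cons.injEq, Sum.inr.injEq, Sum.inl.injEq, and_true] at e
      obtain ⟨rfl, rfl⟩ := e
      rfl

section DualExtension

variable (B A : MonomialQuiver.{u} n)

/-- An arrow of `B`, as an arrow of the dual extension. -/
def arrB (b : B.Arr) : (dualExt B A).Arr := Sum.inl b

/-- An arrow of `Aᵒᵖ`, as an arrow of the dual extension. -/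
def arrA (a : A.op.Arr) : (dualExt B A).Arr := Sum.inr a

/-- A path of `B`, as a path of the dual extension. -/
def pathB (p : B.Path) : (dualExt B A).Path := FinQuiver.Path.inl A.op.toFinQuiver p

variable {B A} in
/-- The path is of the form `q_m ⋯ q_1 p_l ⋯ p_1` with `l, m ≥ 1`, arrows `p_i` of `B` and arrows
`q_j` of `Aᵒᵖ`. -/
def IsMixed (p : (dualExt B A).Path) : Prop :=
  ∃ (l : List B.Arr) (m : List A.op.Arr), l ≠ [] ∧ m ≠ [] ∧
    p.arrows = l.map (arrB B A) ++ m.map (arrA B A)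

/-- `𝒥'`: the part of `Ker δ¹_Λ` in the span of the `b//p` with `b` an arrow of `B` and `p` a mixed
path in `ℬ_Λ`. -/
def idealJ' : Submodule k ((dualExt B A).Arr × (dualExt B A).Path →₀ k) :=
  (dualExt B A).kerDelta1 k ⊓
    Finsupp.supported k k {ap | (∃ b, ap.1 = arrB B A b) ∧ IsBasic ap.2 ∧ IsMixed ap.2}

/-- `Ker δ¹_{Λ|B}`: the elements of `Ker δ¹_Λ` that vanish on the arrows of `B`. -/
def kerRel : Submodule k ((dualExt B A).Arr × (dualExt B A).Path →₀ k) :=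
  (dualExt B A).kerDelta1 k ⊓ ⨅ b, LinearMap.ker ((dualExt B A).val k (arrB B A b))

/-- `𝒥 = 𝒥' + Ker δ¹_{Λ|B}`. -/
def idealJ : Submodule k ((dualExt B A).Arr × (dualExt B A).Path →₀ k) :=
  idealJ' k B A ⊔ kerRel k B A

/-- `ℐ`: the part of `Im δ⁰_Λ` of degree at least two, where `a//p` has degree the length of
`p`. -/
def idealI : Submodule k ((dualExt B A).Arr × (dualExt B A).Path →₀ k) :=
  (dualExt B A).imDelta0 k ⊓ Finsupp.supported k k {ap | 2 ≤ ap.2.arrows.length}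

/-- The linear projection of `k((Q_Λ)₁//ℬ_Λ)` that keeps the pairs `b//p` with `b` an arrow and `p`
a path of `B`, and kills all others. -/
def projB : ((dualExt B A).Arr × (dualExt B A).Path →₀ k) →ₗ[k] (B.Arr × B.Path →₀ k) :=
  Finsupp.lcomapDomain (Prod.map (arrB B A) (pathB B A))
    (Function.Injective.prodMap Sum.inl_injective (inl_injective _ _))

end DualExtension

end MonomialQuiver

end

/-! Both cohomology algebras are computed by the combinatorial complex. Over any monomial algebra,
an element of Ker δ¹ extends by the Leibniz rule to a derivation of the quotient (`derOf`). Every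
derivation becomes one of this kind after subtraction of an inner one (`exists_inner_vertex`,
`exists_derOf_eq`), and the inner ones among them are exactly those from Im δ⁰
(`derOf_mem_innDer_iff`). So HH¹ is Ker δ¹ / Im δ⁰ as a Lie algebra, through the surjection `toHH1`,
and what remains is to study the projection Ker δ¹_Λ → Ker δ¹_B.

Deleting all paths that use an arrow of Aᵒᵖ is an algebra map kQ_Λ → kQ_B (`resB`). Arrows of B go
up and arrows of Aᵒᵖ go down, so no path of B is parallel to an arrow a of Aᵒᵖ, and `resB` kills
x(a). Hence `resB` intertwines the derivation given by x with the one given by its projection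
(`resB_subst`), and the projection is a morphism of Lie algebras. It is onto, because an element of
Ker δ¹_B extended by zero to the arrows of Aᵒᵖ lies in Ker δ¹_Λ.

Its kernel is 𝒥 (`mem_idealJ_iff`), which is therefore an ideal. Split an element of the kernel into
its terms on arrows of B and the others. A basic path parallel to an arrow of B starts in B, and the
paths lying inside B have coefficient zero, so the first part is spanned by mixed paths. That this
part is again in Ker δ¹_Λ is `mem_kerDelta1_of_arrB`: a relation of B sees nothing else, a relation
of Aᵒᵖ does not see it, and a mixed relation αβ becomes x(α)β, where β is followed by an arrow of B.

The projection also maps Im δ⁰_Λ onto Im δ⁰_B, which gives an exact sequence with left term 𝒥 / (𝒥 ∩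
Im δ⁰_Λ). Finally 𝒥 ∩ Im δ⁰_Λ = ℐ. An element of Im δ⁰_Λ is a ↦ af - fa with f a combination of
oriented cycles; let c_i be the coefficient of the vertex i in f. As B has no cycles of positive
length, the projection is b ↦ (c_{s(b)} - c_{t(b)}) b. It vanishes if the element has degree at
least two. Conversely, if it vanishes, then c is constant on the components of Q_B, so it agrees at
the two ends of every arrow of A as well, and the whole degree-one part disappears. This is the only
use of the hypothesis on components. -/

noncomputable section

open scoped Classical

universe u

/-! ### Spans of paths -/

namespace PathAlg

variable {n : ℕ} {k : Type*} [Field k] {Q : FinQuiver.{u} n}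

variable (k) in
/-- The span of a set of paths. -/
def spanOf (S : Set Q.Path) : Submodule k (PathAlg k Q) := Submodule.span k (of k '' S)

theorem of_mem_spanOf {S : Set Q.Path} {p : Q.Path} (hp : p ∈ S) : of k p ∈ spanOf k S :=
  Submodule.subset_span ⟨p, hp, rfl⟩

theorem spanOf_induction {S : Set Q.Path} {P : PathAlg k Q → Prop} (h0 : P 0)
    (hadd : ∀ x y, P x → P y → P (x + y)) (hsmul : ∀ (c : k) x, P x → P (c • x))
    (hof : ∀ p ∈ S, P (of k p)) {x : PathAlg k Q} (hx : x ∈ spanOf k S) : P x := by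
  refine Submodule.span_induction (p := fun x _ => P x) ?_ h0 (fun x y _ _ => hadd x y)
    (fun c x _ => hsmul c x) hx
  rintro _ ⟨p, hp, rfl⟩
  exact hof p hp

theorem of_cons {a : Q.Arr} {l : List Q.Arr} {i j : Fin n} (h : Q.IsPath i (a :: l) j) :
    of k (⟨i, j, a :: l, h⟩ : Q.Path) =
      of k (⟨Q.tgt a, j, l, h.2⟩ : Q.Path) * of k (FinQuiver.Path.arrow Q a) := by
  obtain ⟨rfl, h'⟩ := id h
  exact (of_mul_of_comp (k := k) (l := [a]) (FinQuiver.Path.arrow Q a).isPath h').symm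

/-- Induction on the generators of the path algebra. -/
theorem induction_arrows {P : PathAlg k Q → Prop} (h0 : P 0)
    (hadd : ∀ x y, P x → P y → P (x + y)) (hsmul : ∀ (c : k) x, P x → P (c • x))
    (hv : ∀ i, P (of k (FinQuiver.Path.vertex Q i)))
    (ha : ∀ a, P (of k (FinQuiver.Path.arrow Q a)))
    (hmul : ∀ f g, P f → P g → P (f * g)) (x : PathAlg k Q) : P x := by
  refine induction_paths h0 hadd hsmul (fun p => ?_) x
  obtain ⟨i, j, l, h⟩ := p
  induction l generalizing i with
  | nil => obtain rfl : i = j := h; exact hv i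
  | cons a l ih => rw [of_cons]; exact hmul _ _ (ih _ _) (ha a)

theorem vertex_mul_of (i : Fin n) (p : Q.Path) :
    of k (FinQuiver.Path.vertex Q i) * of k p = if p.target = i then of k p else 0 := by
  obtain ⟨s, t, l, h⟩ := p
  split_ifs with hi
  · obtain rfl : t = i := hi
    have := of_mul_of_comp (k := k) h (show Q.IsPath t [] t from rfl)
    simp only [List.append_nil] at this
    exact this
  · exact of_mul_of_ne hi

theorem of_mul_vertex (i : Fin n) (p : Q.Path) :
    of k p * of k (FinQuiver.Path.vertex Q i) = if p.source = i then of k p else 0 := by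
  obtain ⟨s, t, l, h⟩ := p
  split_ifs with hi
  · obtain rfl : s = i := hi
    exact of_mul_of_comp (k := k) (show Q.IsPath s [] s from rfl) h
  · exact of_mul_of_ne fun e => hi e.symm

theorem vertex_mul_arrow (a : Q.Arr) :
    of k (FinQuiver.Path.vertex Q (Q.tgt a)) * of k (FinQuiver.Path.arrow Q a) =
      of k (FinQuiver.Path.arrow Q a) :=
  (vertex_mul_of _ _).trans (if_pos rfl)

theorem arrow_mul_vertex (a : Q.Arr) :
    of k (FinQuiver.Path.arrow Q a) * of k (FinQuiver.Path.vertex Q (Q.src a)) =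
      of k (FinQuiver.Path.arrow Q a) :=
  (of_mul_vertex _ _).trans (if_pos rfl)

end PathAlg

/-! ### Values on arrows, supports and truncation. -/

namespace MonomialQuiver

variable {n : ℕ} {k : Type*} [Field k] {Q : MonomialQuiver.{u} n}

/-- Since x = ∑ a//x(a), a support condition can be checked one arrow at a time. This moves
questions about pairs into the path algebra, where products are available. -/
theorem mem_supported_iff_val {S : Set (Q.Arr × Q.Path)} {x : Q.Arr × Q.Path →₀ k} :
    x ∈ Finsupp.supported k k S ↔
      ∀ a, Q.val k a x ∈ PathAlg.spanOf k {p | (a, p) ∈ S} := by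
  constructor
  · intro hx a
    rw [Finsupp.supported_eq_span_single] at hx
    refine Submodule.span_induction
      (p := fun x _ => Q.val k a x ∈ PathAlg.spanOf k {p | (a, p) ∈ S}) ?_ (by simp)
      (fun x y _ _ hx hy => by rw [map_add]; exact Submodule.add_mem _ hx hy)
      (fun c x _ hx => by rw [map_smul]; exact Submodule.smul_mem _ _ hx) hx
    rintro _ ⟨⟨b, p⟩, h, rfl⟩
    rw [val_single]
    split_ifs with hb
    · subst hb; exact PathAlg.of_mem_spanOf h
    · exact Submodule.zero_mem _
  · intro h
    rw [← sum_pair_val x]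
    refine Submodule.sum_mem _ fun a _ => ?_
    refine PathAlg.spanOf_induction (P := fun f => Q.pair k a f ∈ Finsupp.supported k k S)
      (by simp) (fun x y hx hy => by rw [map_add]; exact Submodule.add_mem _ hx hy)
      (fun c x hx => by rw [map_smul]; exact Submodule.smul_mem _ _ hx) (fun p hp => ?_) (h a)
    rw [pair_of]
    exact Finsupp.single_mem_supported k 1 hp

theorem val_sum_pair (F : Q.Arr → PathAlg k Q.toFinQuiver) (a : Q.Arr) :
    Q.val k a (∑ b, Q.pair k b (F b)) = F a := by
  simp only [map_sum, val_pair]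
  simp

theorem trunc_eq_self {S : Set Q.Path} (hS : ∀ p ∈ S, IsBasic p) {f : PathAlg k Q.toFinQuiver}
    (hf : f ∈ PathAlg.spanOf k S) : Q.trunc k f = f := by
  refine PathAlg.spanOf_induction (P := fun f => Q.trunc k f = f) (by simp)
    (fun x y hx hy => by rw [map_add, hx, hy]) (fun c x hx => by rw [map_smul, hx])
    (fun p hp => ?_) hf
  rw [trunc_of, if_pos (hS p hp)]

/-- Multiplying by vertices on both sides selects the paths with given endpoints. This is how values
of derivations are shown to be parallel to the arrow. -/
theorem trunc_corner_mem (i j : Fin n) (f : PathAlg k Q.toFinQuiver) :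
    Q.trunc k (PathAlg.of k (FinQuiver.Path.vertex Q.toFinQuiver j) * f *
        PathAlg.of k (FinQuiver.Path.vertex Q.toFinQuiver i)) ∈
      PathAlg.spanOf k {p : Q.Path | IsBasic p ∧ p.source = i ∧ p.target = j} := by
  refine PathAlg.induction_paths (P := fun f => Q.trunc k (PathAlg.of k
      (FinQuiver.Path.vertex Q.toFinQuiver j) * f *
        PathAlg.of k (FinQuiver.Path.vertex Q.toFinQuiver i)) ∈ _) (by simp)
    (fun x y hx hy => by rw [mul_add, add_mul, map_add]; exact Submodule.add_mem _ hx hy)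
    (fun c x hx => by
      rw [mul_smul_comm, smul_mul_assoc, map_smul]; exact Submodule.smul_mem _ _ hx)
    (fun p => ?_) f
  rw [PathAlg.vertex_mul_of]
  split_ifs with hj
  · rw [PathAlg.of_mul_vertex]
    split_ifs with hi
    · rw [trunc_of]
      split_ifs with hp
      · exact PathAlg.of_mem_spanOf ⟨hp, hi, hj⟩
      · exact Submodule.zero_mem _
    · simp
  · simp

theorem mem_C1_iff_val {x : Q.Arr × Q.Path →₀ k} :
    x ∈ Q.C1 k ↔ ∀ a, Q.val k a x ∈ PathAlg.spanOf k
      {p : Q.Path | IsBasic p ∧ p.source = Q.src a ∧ p.target = Q.tgt a} :=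
  mem_supported_iff_val

theorem trunc_val {x : Q.Arr × Q.Path →₀ k} (hx : x ∈ Q.C1 k) (a : Q.Arr) :
    Q.trunc k (Q.val k a x) = Q.val k a x :=
  trunc_eq_self (fun _ h => h.1) (mem_C1_iff_val.1 hx a)

theorem delta1_eq (x : Q.Arr × Q.Path →₀ k) : Q.delta1 k x =
    ∑ r ∈ Q.rel_finite.toFinset, Q.pair k r (Q.trunc k (Q.subst k x (PathAlg.of k r))) := by
  refine pairs_induction (P := fun z => Q.delta1 k z =
      ∑ r ∈ Q.rel_finite.toFinset, Q.pair k r (Q.trunc k (Q.subst k z (PathAlg.of k r))))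
    (by simp) (fun x x' hx hx' => ?_) (fun r x hx => ?_) (fun a γ => ?_) x
  · simp only [map_add, LinearMap.add_apply, hx, hx', Finset.sum_add_distrib]
  · simp only [map_smul, LinearMap.smul_apply, hx, Finset.smul_sum]
  · rw [delta1, Finsupp.linearCombination_single, one_smul]
    simp only [subst_single_of, replace]

theorem mem_kerDelta1_of {x : Q.Arr × Q.Path →₀ k} (hx : x ∈ Q.C1 k)
    (h : ∀ r ∈ Q.rel, Q.trunc k (Q.subst k x (PathAlg.of k r)) = 0) : x ∈ Q.kerDelta1 k := by
  refine ⟨hx, LinearMap.mem_ker.2 ?_⟩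
  rw [delta1_eq]
  refine Finset.sum_eq_zero fun r hr => ?_
  rw [h r (by simpa using hr), map_zero]

/-! ### The monomial algebra and the basis of paths -/

/-- The kernel of `trunc` contains the relations, and it is a two-sided ideal because a product may
be truncated factor by factor. Together with `sub_trunc_mem` this makes it equal to the relation
ideal, so ℬ gives a basis of the quotient. -/
theorem trunc_eq_zero_of_mem {f : PathAlg k Q.toFinQuiver} (hf : f ∈ Q.relIdeal k) :
    Q.trunc k f = 0 := by
  rw [relIdeal] at hf
  induction hf using TwoSidedIdeal.span_induction with
  | mem f hf =>
    obtain ⟨r, hr, rfl⟩ := hf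
    rw [trunc_of, if_neg]
    exact fun hb => hb r hr List.infix_rfl
  | zero => exact map_zero _
  | add f g _ _ hf hg => rw [map_add, hf, hg, add_zero]
  | neg f _ hf => rw [map_neg, hf, neg_zero]
  | left_absorb a f _ hf => rw [← trunc_mul_right, hf, mul_zero, map_zero]
  | right_absorb a f _ hf => rw [← trunc_mul_left, hf, zero_mul, map_zero]

theorem sub_trunc_mem (f : PathAlg k Q.toFinQuiver) : f - Q.trunc k f ∈ Q.relIdeal k := by
  refine PathAlg.induction_paths (P := fun f => f - Q.trunc k f ∈ Q.relIdeal k)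
    (by simp) (fun x y hx hy => ?_) (fun c x hx => ?_)
    (fun p => ?_) f
  · rw [map_add, add_sub_add_comm]
    exact (Q.relIdeal k).add_mem hx hy
  · rw [map_smul, ← smul_sub, ← one_mul (x - _), ← smul_mul_assoc]
    exact (Q.relIdeal k).mul_mem_left _ _ hx
  rw [trunc_of]
  split_ifs with hp
  · rw [sub_self]; exact (Q.relIdeal k).zero_mem
  rw [sub_zero]
  simp only [IsBasic, not_forall, not_not] at hp
  -- A path outside ℬ factors as v r u with r a relation, hence lies in the ideal.
  obtain ⟨r, hr, u, v, huv⟩ := hp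
  obtain ⟨i, j, l, hl⟩ := p
  obtain ⟨i', j', l', hl'⟩ := r
  simp only at huv
  subst huv
  obtain ⟨m', h12, h3⟩ := Q.isPath_append.1 hl
  obtain ⟨m, h1, h2⟩ := Q.isPath_append.1 h12
  have hne : l' ≠ [] := by
    have := Q.two_le_length _ hr
    rintro rfl
    simp at this
  obtain ⟨a, l'', rfl⟩ := List.exists_cons_of_ne_nil hne
  obtain rfl : i' = m := hl'.1.symm.trans h2.1
  obtain rfl : j' = m' := hl'.target_unique h2
  have e : (PathAlg.of k ⟨i, j, u ++ (a :: l'') ++ v, hl⟩ : PathAlg k Q.toFinQuiver) =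
      PathAlg.of k ⟨j', j, v, h3⟩ * (PathAlg.of k ⟨i', j', a :: l'', hl'⟩ *
        PathAlg.of k ⟨i, i', u, h1⟩) := by
    rw [PathAlg.of_mul_of_comp, PathAlg.of_mul_of_comp]
  rw [e]
  exact (Q.relIdeal k).mul_mem_left _ _ ((Q.relIdeal k).mul_mem_right _ _
    (TwoSidedIdeal.subset_span ⟨_, hr, rfl⟩))

variable (k Q) in
/-- The quotient map from the path algebra to the monomial algebra. -/
def toAlg : PathAlg k Q.toFinQuiver →ₐ[k] Q.Alg k := Ideal.Quotient.mkₐ k _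

theorem mk_eq_toAlg (f : PathAlg k Q.toFinQuiver) :
    (Ideal.Quotient.mk _ f : Q.Alg k) = Q.toAlg k f := rfl

theorem cls_eq_toAlg (p : Q.Path) : Q.cls k p = Q.toAlg k (PathAlg.of k p) := rfl

theorem toAlg_surjective : Function.Surjective (Q.toAlg k) := Ideal.Quotient.mk_surjective

theorem toAlg_trunc (f : PathAlg k Q.toFinQuiver) : Q.toAlg k (Q.trunc k f) = Q.toAlg k f :=
  (Ideal.Quotient.eq.2 (TwoSidedIdeal.mem_asIdeal.2 (sub_trunc_mem f))).symm

theorem toAlg_eq_iff {f g : PathAlg k Q.toFinQuiver} :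
    Q.toAlg k f = Q.toAlg k g ↔ Q.trunc k f = Q.trunc k g := by
  constructor
  · intro h
    have := trunc_eq_zero_of_mem (TwoSidedIdeal.mem_asIdeal.1 (Ideal.Quotient.eq.1 h))
    rwa [map_sub, sub_eq_zero] at this
  · intro h
    rw [← toAlg_trunc f, h, toAlg_trunc]

variable (k Q) in
/-- The linear section of the quotient map whose image is the span of `ℬ`. -/
def normalForm : Q.Alg k →ₗ[k] PathAlg k Q.toFinQuiver where
  -- The arbitrary choice of a representative is harmless: the truncation depends only on the class.
  toFun u := Q.trunc k (Function.surjInv toAlg_surjective u)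
  map_add' u v := by
    rw [← map_add, ← toAlg_eq_iff, map_add]
    simp only [Function.surjInv_eq]
  map_smul' c u := by
    rw [RingHom.id_apply, ← map_smul, ← toAlg_eq_iff, map_smul]
    simp only [Function.surjInv_eq]

theorem normalForm_toAlg (f : PathAlg k Q.toFinQuiver) :
    Q.normalForm k (Q.toAlg k f) = Q.trunc k f :=
  toAlg_eq_iff.1 (Function.surjInv_eq toAlg_surjective _)

theorem toAlg_normalForm (u : Q.Alg k) : Q.toAlg k (Q.normalForm k u) = u := by
  obtain ⟨f, rfl⟩ := toAlg_surjective u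
  rw [normalForm_toAlg, toAlg_trunc]

/-! ### Derivations of a monomial algebra -/

variable (k Q) in
/-- The derivation of the monomial algebra that corresponds to an element of `Ker δ¹`. -/
def derOf : Q.kerDelta1 k →ₗ⁅k⁆ algDer k (Q.Alg k) where
  toFun x := ⟨(Q.toAlg k).toLinearMap ∘ₗ Q.subst k x.1 ∘ₗ Q.normalForm k, by
    intro u v
    obtain ⟨f, rfl⟩ := toAlg_surjective u
    obtain ⟨g, rfl⟩ := toAlg_surjective v
    simp only [LinearMap.comp_apply, AlgHom.toLinearMap_apply]
    rw [← map_mul, normalForm_toAlg, normalForm_toAlg, normalForm_toAlg]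
    -- Here δ¹ x = 0 enters: substitution respects the relations, so truncating beforehand does not
    -- change the resulting class and the Leibniz rule descends from the path algebra.
    simp only [toAlg_eq_iff.2 (trunc_subst_trunc x.2 _)]
    rw [subst_mul x.2.1, map_add, map_mul, map_mul]⟩
  map_add' x y := algDer_ext fun u => by
    simp
  map_smul' c x := algDer_ext fun u => by
    simp
  map_lie' := by
    intro x y
    refine algDer_ext fun u => ?_
    obtain ⟨f, rfl⟩ := toAlg_surjective u
    rw [algDer_lie_apply]
    simp only [LinearMap.comp_apply, AlgHom.toLinearMap_apply, normalForm_toAlg]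
    rw [← map_sub, toAlg_eq_iff, map_sub, coe_lie, trunc_subst_br x.2 y.2]
    have h : ∀ v w : Q.kerDelta1 k, Q.trunc k (Q.subst k v.1 (Q.subst k w.1 (Q.trunc k f))) =
        Q.trunc k (Q.subst k v.1 (Q.subst k w.1 f)) := fun v w => by
      rw [← trunc_subst_trunc v.2, trunc_subst_trunc w.2, trunc_subst_trunc v.2]
    rw [h, h, trunc_subst_trunc x.2, trunc_subst_trunc y.2, h, h]

theorem derOf_toAlg (x : Q.kerDelta1 k) (f : PathAlg k Q.toFinQuiver) :
    (Q.derOf k x).1 (Q.toAlg k f) = Q.toAlg k (Q.subst k x.1 f) := by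
  change Q.toAlg k (Q.subst k x.1 (Q.normalForm k (Q.toAlg k f))) = _
  rw [normalForm_toAlg]
  exact toAlg_eq_iff.2 (trunc_subst_trunc x.2 _)

theorem represents_derOf (x : Q.kerDelta1 k) : Represents k x.1 (Q.derOf k x) := by
  refine ⟨fun i => ?_, fun a => ?_⟩
  · rw [cls_eq_toAlg, derOf_toAlg, subst_vertex _ _ rfl, map_zero]
  · rw [cls_eq_toAlg, derOf_toAlg, subst_arrow x.2.1, mk_eq_toAlg]

theorem Represents.apply_toAlg {x : Q.Arr × Q.Path →₀ k} (hx : x ∈ Q.C1 k)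
    {D : algDer k (Q.Alg k)} (hD : Represents k x D) (f : PathAlg k Q.toFinQuiver) :
    D.1 (Q.toAlg k f) = Q.toAlg k (Q.subst k x f) := by
  refine PathAlg.induction_arrows (P := fun f => D.1 (Q.toAlg k f) = Q.toAlg k (Q.subst k x f))
    (by simp) (fun f g hf hg => by simp only [map_add, hf, hg])
    (fun c f hf => by simp only [map_smul, hf]) (fun i => ?_) (fun a => ?_)
    (fun f g hf hg => ?_) f
  · rw [subst_vertex _ _ rfl, map_zero]; exact hD.1 i
  · rw [subst_arrow hx]; exact hD.2 a
  · rw [map_mul, algDer_leibniz, hf, hg, subst_mul hx, map_add, map_mul, map_mul]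

/-- A relation has class zero, so D sends it to zero. Computed by substitution and truncation, this
is the condition δ¹ x = 0. -/
theorem Represents.mem_kerDelta1 {x : Q.Arr × Q.Path →₀ k} (hx : x ∈ Q.C1 k)
    {D : algDer k (Q.Alg k)} (hD : Represents k x D) : x ∈ Q.kerDelta1 k := by
  refine mem_kerDelta1_of hx fun r hr => ?_
  have h : Q.toAlg k (PathAlg.of k r) = Q.toAlg k 0 := by
    rw [toAlg_eq_iff, trunc_of, if_neg, map_zero]
    exact fun hb => hb r hr List.infix_rfl
  rw [← map_zero (Q.trunc k), ← toAlg_eq_iff, ← hD.apply_toAlg hx, h, map_zero, map_zero]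

theorem Represents.derOf_eq {x : Q.Arr × Q.Path →₀ k} (hx : x ∈ Q.kerDelta1 k)
    {D : algDer k (Q.Alg k)} (hD : Represents k x D) : Q.derOf k ⟨x, hx⟩ = D := by
  refine algDer_ext fun u => ?_
  obtain ⟨f, rfl⟩ := toAlg_surjective u
  rw [derOf_toAlg, hD.apply_toAlg hx.1]

/-- A derivation that vanishes on the vertices comes from an element of `Ker δ¹`. -/
theorem exists_derOf_eq {D : algDer k (Q.Alg k)}
    (hD : ∀ i, D.1 (Q.cls k (FinQuiver.Path.vertex Q.toFinQuiver i)) = 0) :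
    ∃ x : Q.kerDelta1 k, Q.derOf k x = D := by
  set x : Q.Arr × Q.Path →₀ k := ∑ a, Q.pair k a
    (Q.normalForm k (D.1 (Q.cls k (FinQuiver.Path.arrow Q.toFinQuiver a)))) with hxd
  have hval : ∀ a, Q.val k a x =
      Q.normalForm k (D.1 (Q.cls k (FinQuiver.Path.arrow Q.toFinQuiver a))) :=
    fun a => val_sum_pair _ a
  have hx : x ∈ Q.C1 k := by
    rw [mem_C1_iff_val]
    intro a
    -- Applying D to a = e_t a e_s, with D zero on e_s and e_t, gives D(a) = e_t D(a) e_s. So the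
    -- normal form of D(a) is supported on paths parallel to a.
    have e : PathAlg.of k (FinQuiver.Path.vertex Q.toFinQuiver (Q.tgt a)) *
        PathAlg.of k (FinQuiver.Path.arrow Q.toFinQuiver a) *
          PathAlg.of k (FinQuiver.Path.vertex Q.toFinQuiver (Q.src a)) =
        PathAlg.of k (FinQuiver.Path.arrow Q.toFinQuiver a) := by
      rw [PathAlg.vertex_mul_arrow, PathAlg.arrow_mul_vertex]
    have h : D.1 (Q.cls k (FinQuiver.Path.arrow Q.toFinQuiver a)) =
        Q.cls k (FinQuiver.Path.vertex Q.toFinQuiver (Q.tgt a)) *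
          D.1 (Q.cls k (FinQuiver.Path.arrow Q.toFinQuiver a)) *
          Q.cls k (FinQuiver.Path.vertex Q.toFinQuiver (Q.src a)) := by
      conv_lhs => rw [cls_eq_toAlg, ← e, map_mul (Q.toAlg k), map_mul (Q.toAlg k), algDer_leibniz,
        algDer_leibniz]
      simp only [← cls_eq_toAlg, hD]
      simp
    rw [hval]
    generalize D.1 (Q.cls k (FinQuiver.Path.arrow Q.toFinQuiver a)) = w at h
    obtain ⟨f, rfl⟩ := toAlg_surjective w
    rw [h]
    simp only [cls_eq_toAlg, ← map_mul, normalForm_toAlg]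
    exact trunc_corner_mem _ _ _
  have hr : Represents k x D := ⟨hD, fun a => by rw [hval, mk_eq_toAlg, toAlg_normalForm]⟩
  exact ⟨⟨x, hr.mem_kerDelta1 hx⟩, hr.derOf_eq _⟩

/-- The inner derivation `x ↦ c x - x c`. -/
def adDer {R : Type*} [Ring R] [Algebra k R] (c : R) : algDer k R :=
  ⟨LinearMap.mulLeft k c - LinearMap.mulRight k c, fun x y => by
    simp only [LinearMap.sub_apply, LinearMap.mulLeft_apply, LinearMap.mulRight_apply]
    noncomm_ring⟩

theorem adDer_apply {R : Type*} [Ring R] [Algebra k R] (c x : R) :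
    (adDer (k := k) c).1 x = c * x - x * c := rfl

theorem adDer_mem_innDer {R : Type*} [Ring R] [Algebra k R] (c : R) :
    adDer c ∈ innDer k R := ⟨c, fun _ => rfl⟩

theorem sum_cls_vertex :
    ∑ i, Q.cls k (FinQuiver.Path.vertex Q.toFinQuiver i) = 1 := by
  simp only [cls_eq_toAlg]
  rw [← map_sum, ← PathAlg.one_def, map_one]

theorem cls_vertex_mul (i j : Fin n) :
    Q.cls k (FinQuiver.Path.vertex Q.toFinQuiver i) *
      Q.cls k (FinQuiver.Path.vertex Q.toFinQuiver j) =
      if j = i then Q.cls k (FinQuiver.Path.vertex Q.toFinQuiver j) else 0 := by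
  rw [cls_eq_toAlg, cls_eq_toAlg, ← map_mul, PathAlg.vertex_mul_of]
  split_ifs with h h' h'
  · rfl
  · exact absurd h h'
  · exact absurd h' h
  · exact map_zero _

/-- Every derivation vanishes on the vertices, up to an inner derivation. -/
theorem exists_inner_vertex (D : algDer k (Q.Alg k)) :
    ∃ c : Q.Alg k, ∀ j, (D - adDer c).1
      (Q.cls k (FinQuiver.Path.vertex Q.toFinQuiver j)) = 0 := by
  set e : Fin n → Q.Alg k := fun i => Q.cls k (FinQuiver.Path.vertex Q.toFinQuiver i) with he
  have hmul : ∀ i j, e i * e j = if j = i then e j else 0 := cls_vertex_mul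
  have hsum : ∑ i, e i = 1 := sum_cls_vertex
  -- The element c = ∑ D(e_i) e_i satisfies [c, e_j] = D(e_j): orthogonality gives c e_j = D(e_j)
  -- e_j, and the Leibniz rule on e_j e_i gives e_j c = D(e_j) e_j - D(e_j).
  refine ⟨∑ i, D.1 (e i) * e i, fun j => ?_⟩
  change D.1 (e j) - ((∑ i, D.1 (e i) * e i) * e j - e j * ∑ i, D.1 (e i) * e i) = 0
  have h1 : (∑ i, D.1 (e i) * e i) * e j = D.1 (e j) * e j := by
    simp only [Finset.sum_mul, mul_assoc, hmul, mul_ite, mul_zero]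
    simp
  have h2 : ∀ i, e j * (D.1 (e i) * e i) = if i = j then 0 else - (D.1 (e j) * e i) := by
    intro i
    have h := algDer_leibniz D (e j) (e i)
    rw [hmul] at h
    have h' : e j * D.1 (e i) = D.1 (if i = j then e i else 0) - D.1 (e j) * e i := by
      rw [h]; abel
    rw [← mul_assoc, h', sub_mul, mul_assoc, hmul, if_pos rfl]
    split_ifs with hij
    · subst hij; exact sub_self _
    · rw [map_zero, zero_mul, zero_sub]
  have h3 : e j * ∑ i, D.1 (e i) * e i = D.1 (e j) * e j - D.1 (e j) := by
    rw [Finset.mul_sum]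
    simp only [h2]
    have h4 : ∑ i, D.1 (e j) * e i = D.1 (e j) := by rw [← Finset.mul_sum, hsum, mul_one]
    -- The term i = j is set apart: it is zero in the goal and D(e_j) e_j in `h4`, while the other
    -- terms differ only by sign.
    rw [← Finset.add_sum_erase _ _ (Finset.mem_univ j)] at h4 ⊢
    rw [if_pos rfl, zero_add, Finset.sum_congr rfl (g := fun i => - (D.1 (e j) * e i))
      (fun i hi => if_neg (Finset.ne_of_mem_erase hi)), Finset.sum_neg_distrib]
    rw [← sub_eq_iff_eq_add'.2 h4.symm]
    abel
  rw [h1, h3]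
  abel

/-! ### The image of `δ⁰` -/

theorem of_arrow_mul_of (a : Q.Arr) (p : Q.Path) :
    PathAlg.of k (FinQuiver.Path.arrow Q.toFinQuiver a) * PathAlg.of k p =
      if Q.src a = p.target then
        PathAlg.pathOrZero k Q.toFinQuiver p.source (p.arrows ++ [a]) (Q.tgt a) else 0 := by
  rw [PathAlg.of_mul_of, PathAlg.mulPath]
  exact if_congr eq_comm rfl rfl

theorem of_mul_of_arrow (a : Q.Arr) (p : Q.Path) :
    PathAlg.of k p * PathAlg.of k (FinQuiver.Path.arrow Q.toFinQuiver a) =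
      if Q.tgt a = p.source then
        PathAlg.pathOrZero k Q.toFinQuiver (Q.src a) (a :: p.arrows) p.target else 0 := by
  rw [PathAlg.of_mul_of, PathAlg.mulPath]
  rfl

variable (Q) in
/-- The oriented cycles in `ℬ`, including the vertices. -/
def cyclicBasic : Set Q.Path := {p | IsBasic p ∧ p.source = p.target}

theorem val_delta0_single {i : Fin n} {p : Q.Path} (hs : p.source = i) (ht : p.target = i)
    (a : Q.Arr) :
    Q.val k a (Q.delta0 k (Finsupp.single (i, p) 1)) =
      Q.trunc k (PathAlg.of k (FinQuiver.Path.arrow Q.toFinQuiver a) * PathAlg.of k p -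
        PathAlg.of k p * PathAlg.of k (FinQuiver.Path.arrow Q.toFinQuiver a)) := by
  rw [delta0, Finsupp.linearCombination_single, one_smul, map_sub, map_sum, map_sum,
    of_arrow_mul_of, of_mul_of_arrow, map_sub, hs, ht]
  simp only [apply_ite (Q.val k a), apply_ite (Q.trunc k), val_pair, map_zero]
  congr 1
  · rw [Finset.sum_eq_single a (fun b _ hb => by simp [hb]) (by simp)]
    simp
  · rw [Finset.sum_eq_single a (fun b _ hb => by simp [hb]) (by simp)]
    simp

/-- In e//p the vertex e is determined by the cycle p, so δ⁰ is a commutator with a combination f of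
basic cycles. All later arguments about Im δ⁰ use this description. -/
theorem mem_imDelta0_iff {x : Q.Arr × Q.Path →₀ k} :
    x ∈ Q.imDelta0 k ↔ ∃ f ∈ PathAlg.spanOf k Q.cyclicBasic, ∀ a, Q.val k a x =
      Q.trunc k (PathAlg.of k (FinQuiver.Path.arrow Q.toFinQuiver a) * f -
        f * PathAlg.of k (FinQuiver.Path.arrow Q.toFinQuiver a)) := by
  constructor
  · rintro ⟨c, hc, rfl⟩
    change c ∈ Q.C0 k at hc
    rw [C0, Finsupp.supported_eq_span_single] at hc
    refine Submodule.span_induction (p := fun c _ => ∃ f ∈ PathAlg.spanOf k Q.cyclicBasic,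
      ∀ a, Q.val k a (Q.delta0 k c) =
        Q.trunc k (PathAlg.of k (FinQuiver.Path.arrow Q.toFinQuiver a) * f -
          f * PathAlg.of k (FinQuiver.Path.arrow Q.toFinQuiver a))) ?_ ?_ ?_ ?_ hc
    · rintro _ ⟨⟨i, p⟩, ⟨hb, hs, ht⟩, rfl⟩
      exact ⟨_, PathAlg.of_mem_spanOf ⟨hb, hs.trans ht.symm⟩, val_delta0_single hs ht⟩
    · exact ⟨0, Submodule.zero_mem _, fun a => by simp⟩
    · rintro c d _ _ ⟨f, hf, hf'⟩ ⟨g, hg, hg'⟩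
      refine ⟨f + g, Submodule.add_mem _ hf hg, fun a => ?_⟩
      rw [map_add, map_add, hf', hg', ← map_add, mul_add, add_mul]
      congr 1
      abel
    · rintro r c _ ⟨f, hf, hf'⟩
      refine ⟨r • f, Submodule.smul_mem _ _ hf, fun a => ?_⟩
      rw [map_smul, map_smul, hf', ← map_smul, smul_sub, mul_smul_comm, smul_mul_assoc]
  · rintro ⟨f, hf, h⟩
    have : ∃ c ∈ Q.C0 k, ∀ a, Q.val k a (Q.delta0 k c) =
        Q.trunc k (PathAlg.of k (FinQuiver.Path.arrow Q.toFinQuiver a) * f -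
          f * PathAlg.of k (FinQuiver.Path.arrow Q.toFinQuiver a)) := by
      refine PathAlg.spanOf_induction (P := fun f => ∃ c ∈ Q.C0 k, ∀ a,
        Q.val k a (Q.delta0 k c) =
        Q.trunc k (PathAlg.of k (FinQuiver.Path.arrow Q.toFinQuiver a) * f -
          f * PathAlg.of k (FinQuiver.Path.arrow Q.toFinQuiver a))) ?_ ?_ ?_ ?_ hf
      · exact ⟨0, Submodule.zero_mem _, fun a => by simp⟩
      · rintro f g ⟨c, hc, hc'⟩ ⟨d, hd, hd'⟩
        refine ⟨c + d, Submodule.add_mem _ hc hd, fun a => ?_⟩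
        rw [map_add, map_add, hc', hd', ← map_add, mul_add, add_mul]
        congr 1
        abel
      · rintro r f ⟨c, hc, hc'⟩
        refine ⟨r • c, Submodule.smul_mem _ _ hc, fun a => ?_⟩
        rw [map_smul, map_smul, hc', ← map_smul, smul_sub, mul_smul_comm, smul_mul_assoc]
      · rintro p ⟨hb, hp⟩
        exact ⟨Finsupp.single (p.source, p) 1,
          Finsupp.single_mem_supported k 1 ⟨hb, rfl, hp.symm⟩, val_delta0_single rfl hp.symm⟩
    obtain ⟨c, hc, hc'⟩ := this
    exact ⟨c, hc, val_ext fun a => by rw [hc', h]⟩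

theorem vertex_commute {f : PathAlg k Q.toFinQuiver} (hf : f ∈ PathAlg.spanOf k Q.cyclicBasic)
    (i : Fin n) :
    f * PathAlg.of k (FinQuiver.Path.vertex Q.toFinQuiver i) =
      PathAlg.of k (FinQuiver.Path.vertex Q.toFinQuiver i) * f := by
  refine PathAlg.spanOf_induction (P := fun f => f * PathAlg.of k
      (FinQuiver.Path.vertex Q.toFinQuiver i) =
      PathAlg.of k (FinQuiver.Path.vertex Q.toFinQuiver i) * f) (by simp)
    (fun f g hf hg => by rw [add_mul, mul_add, hf, hg])
    (fun c f hf => by rw [smul_mul_assoc, mul_smul_comm, hf]) (fun p hp => ?_) hf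
  rw [PathAlg.vertex_mul_of, PathAlg.of_mul_vertex, hp.2]

/-- A combination of cycles commutes with every vertex, so af and fa stay in the corner e_t(·)e_s of
the arrow. -/
theorem trunc_src_tgt_mem {f : PathAlg k Q.toFinQuiver}
    (hf : f ∈ PathAlg.spanOf k Q.cyclicBasic) (a : Q.Arr) :
    Q.trunc k (PathAlg.of k (FinQuiver.Path.arrow Q.toFinQuiver a) * f -
        f * PathAlg.of k (FinQuiver.Path.arrow Q.toFinQuiver a)) ∈ PathAlg.spanOf k
      {p : Q.Path | IsBasic p ∧ p.source = Q.src a ∧ p.target = Q.tgt a} := by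
  set s := PathAlg.of k (FinQuiver.Path.vertex Q.toFinQuiver (Q.src a)) with hs
  set t := PathAlg.of k (FinQuiver.Path.vertex Q.toFinQuiver (Q.tgt a)) with ht
  set b := PathAlg.of k (FinQuiver.Path.arrow Q.toFinQuiver a) with hb
  have h1 : t * b = b := PathAlg.vertex_mul_arrow a
  have h2 : b * s = b := PathAlg.arrow_mul_vertex a
  have e : b * f - f * b = t * (b * f - f * b) * s := by
    have e1 : t * (b * f) * s = b * f := by
      rw [← mul_assoc, h1, mul_assoc, vertex_commute hf, ← mul_assoc, h2]
    have e2 : t * (f * b) * s = f * b := by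
      rw [← mul_assoc, ← vertex_commute hf, mul_assoc, mul_assoc, h2, h1]
    rw [mul_sub, sub_mul, e1, e2]
  rw [e]
  exact trunc_corner_mem _ _ _

/-- The sign reconciles two conventions: δ⁰ is a ↦ af - fa, whereas the inner derivation of c is x ↦
cx - xc. -/
theorem represents_of_val {x : Q.Arr × Q.Path →₀ k} {f : PathAlg k Q.toFinQuiver}
    (hf : f ∈ PathAlg.spanOf k Q.cyclicBasic)
    (h : ∀ a, Q.val k a x = Q.trunc k (PathAlg.of k (FinQuiver.Path.arrow Q.toFinQuiver a) * f -
        f * PathAlg.of k (FinQuiver.Path.arrow Q.toFinQuiver a))) :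
    Represents k x (adDer (Q.toAlg k (-f))) := by
  refine ⟨fun i => ?_, fun a => ?_⟩
  · rw [adDer_apply, cls_eq_toAlg, ← map_mul, ← map_mul, ← map_sub, neg_mul, mul_neg,
      vertex_commute hf, sub_self, map_zero]
  · rw [adDer_apply, cls_eq_toAlg, ← map_mul, ← map_mul, ← map_sub, mk_eq_toAlg, h, toAlg_trunc]
    congr 1
    noncomm_ring

theorem imDelta0_le_kerDelta1 : Q.imDelta0 k ≤ Q.kerDelta1 k := by
  intro x hx
  obtain ⟨f, hf, h⟩ := mem_imDelta0_iff.1 hx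
  refine (represents_of_val hf h).mem_kerDelta1 (mem_C1_iff_val.2 fun a => ?_)
  rw [h]
  exact trunc_src_tgt_mem hf a

/-- An element commuting with the vertices equals ∑ e_i c e_i, and each summand is a combination of
cycles at i. -/
theorem normalForm_mem_of_commute {c : Q.Alg k}
    (hc : ∀ i, c * Q.cls k (FinQuiver.Path.vertex Q.toFinQuiver i) =
      Q.cls k (FinQuiver.Path.vertex Q.toFinQuiver i) * c) :
    Q.normalForm k c ∈ PathAlg.spanOf k Q.cyclicBasic := by
  have h : c = ∑ i, Q.cls k (FinQuiver.Path.vertex Q.toFinQuiver i) * c *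
      Q.cls k (FinQuiver.Path.vertex Q.toFinQuiver i) := by
    simp only [← hc, mul_assoc, cls_vertex_mul, if_true]
    rw [← Finset.mul_sum, sum_cls_vertex, mul_one]
  obtain ⟨f, rfl⟩ := toAlg_surjective c
  rw [h, map_sum]
  refine Submodule.sum_mem _ fun i _ => ?_
  simp only [cls_eq_toAlg, ← map_mul, normalForm_toAlg]
  refine Submodule.span_mono (Set.image_mono ?_) (trunc_corner_mem i i f)
  rintro p ⟨hb, h1, h2⟩
  exact ⟨hb, h1.trans h2.symm⟩

/-! ### Identification of Ker δ¹ / Im δ⁰ with the first Hochschild cohomology. -/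

/-- If the derivation is inner, given by c, then c commutes with the vertices because the derivation
kills them. Its normal form is then a combination of basic cycles, whose negative is the required f.
-/
theorem derOf_mem_innDer_iff (x : Q.kerDelta1 k) :
    Q.derOf k x ∈ innDer k (Q.Alg k) ↔ x.1 ∈ Q.imDelta0 k := by
  constructor
  · rintro ⟨c, hc⟩
    have hx := represents_derOf x
    have hcomm : ∀ i, c * Q.cls k (FinQuiver.Path.vertex Q.toFinQuiver i) =
        Q.cls k (FinQuiver.Path.vertex Q.toFinQuiver i) * c := fun i => by
      rw [← sub_eq_zero, ← hc, hx.1]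
    refine mem_imDelta0_iff.2 ⟨-Q.normalForm k c,
      Submodule.neg_mem _ (normalForm_mem_of_commute hcomm), fun a => ?_⟩
    rw [← trunc_val x.2.1, ← toAlg_eq_iff, ← mk_eq_toAlg, ← hx.2 a, hc]
    simp only [map_sub, map_mul, map_neg, toAlg_normalForm, cls_eq_toAlg]
    noncomm_ring
  · intro hx
    obtain ⟨f, hf, h⟩ := mem_imDelta0_iff.1 hx
    rw [(represents_of_val hf h).derOf_eq x.2]
    exact adDer_mem_innDer _

/-- Transported along `derOf`, this is the fact that inner derivations form an ideal. -/
theorem lie_mem_imDelta0 (x : Q.kerDelta1 k) {z : Q.kerDelta1 k} (hz : z.1 ∈ Q.imDelta0 k) :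
    (⁅x, z⁆ : Q.kerDelta1 k).1 ∈ Q.imDelta0 k := by
  rw [← derOf_mem_innDer_iff] at hz ⊢
  rw [LieHom.map_lie]
  exact lie_mem_right k _ _ _ _ hz

variable (k Q) in
/-- The projection of `Ker δ¹` onto the first Hochschild cohomology. -/
def toHH1 : Q.kerDelta1 k →ₗ⁅k⁆ HH1 k (Q.Alg k) where
  toFun x := LieSubmodule.Quotient.mk (Q.derOf k x)
  map_add' x y := by rw [map_add]; rfl
  map_smul' c x := by rw [map_smul]; rfl
  map_lie' := by intro x y; rw [LieHom.map_lie]; rfl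

theorem toHH1_eq_zero_iff (x : Q.kerDelta1 k) : Q.toHH1 k x = 0 ↔ x.1 ∈ Q.imDelta0 k := by
  rw [← derOf_mem_innDer_iff]
  exact LieSubmodule.Quotient.mk_eq_zero'

theorem toHH1_surjective : Function.Surjective (Q.toHH1 k) := by
  intro u
  obtain ⟨D, rfl⟩ := LieSubmodule.Quotient.surjective_mk' _ u
  obtain ⟨c, hc⟩ := exists_inner_vertex D
  obtain ⟨x, hx⟩ := exists_derOf_eq hc
  refine ⟨x, ?_⟩
  change LieSubmodule.Quotient.mk' (innDer k (Q.Alg k)) (Q.derOf k x) = _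
  rw [← sub_eq_zero, ← map_sub, hx, LieSubmodule.Quotient.mk_eq_zero, sub_sub_cancel_left]
  exact Submodule.neg_mem _ (adDer_mem_innDer c)

end MonomialQuiver

end

noncomputable section

open scoped Classical

universe u

/-! ### Coefficients and degrees -/

namespace FinQuiver

variable {n : ℕ} {Q : FinQuiver.{u} n}

theorem IsDirected.le_of_isPath (hQ : Q.IsDirected) {l : List Q.Arr} {i j : Fin n}
    (h : Q.IsPath i l j) : i ≤ j := by
  induction l generalizing i with
  | nil => exact le_of_eq h
  | cons a l ih =>
    obtain ⟨rfl, h⟩ := h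
    exact (hQ a).le.trans (ih h)

theorem IsDirected.eq_nil_of_isPath (hQ : Q.IsDirected) {l : List Q.Arr} {i : Fin n}
    (h : Q.IsPath i l i) : l = [] := by
  cases l with
  | nil => rfl
  | cons a l =>
    obtain ⟨rfl, h⟩ := h
    exact absurd (hQ.le_of_isPath h) (not_le.2 (hQ a))

theorem eq_of_linked {T : Type*} (c : Fin n → T)
    (h : ∀ a : Q.Arr, c (Q.src a) = c (Q.tgt a)) {i j : Fin n} (hij : Q.Linked i j) :
    c i = c j := by
  induction hij with
  | rel i j h' => obtain ⟨a, rfl, rfl⟩ := h'; exact h a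
  | refl i => rfl
  | symm i j _ ih => exact ih.symm
  | trans i j l _ _ ih ih' => exact ih.trans ih'

end FinQuiver

namespace PathAlg

variable {n : ℕ} {k : Type*} [Field k] {Q : FinQuiver.{u} n}

variable (k) in
/-- The coefficient of a path. -/
def coef (p : Q.Path) : PathAlg k Q →ₗ[k] k := lift fun q => if q = p then 1 else 0

theorem coef_of (p q : Q.Path) : coef k p (of k q) = if q = p then 1 else 0 := lift_of _ _

theorem coef_eq_zero {S : Set Q.Path} {p : Q.Path} (hp : p ∉ S) {f : PathAlg k Q}
    (hf : f ∈ spanOf k S) : coef k p f = 0 := by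
  refine spanOf_induction (P := fun f => coef k p f = 0) (by simp)
    (fun x y hx hy => by rw [map_add, hx, hy, add_zero])
    (fun c x hx => by rw [map_smul, hx, smul_zero]) (fun q hq => ?_) hf
  rw [coef_of, if_neg]
  rintro rfl
  exact hp hq

/-- The part of degree zero. -/
def degZero (f : PathAlg k Q) : PathAlg k Q :=
  ∑ i, coef k (FinQuiver.Path.vertex Q i) f • of k (FinQuiver.Path.vertex Q i)

theorem sub_degZero_mem (f : PathAlg k Q) :
    f - degZero f ∈ spanOf k {p : Q.Path | p.arrows ≠ []} := by
  refine induction_paths (P := fun f => f - degZero f ∈ spanOf k {p : Q.Path | p.arrows ≠ []})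
    (by simp [degZero]) (fun x y hx hy => ?_) (fun c x hx => ?_) (fun p => ?_) f
  · have : x + y - degZero (x + y) = (x - degZero x) + (y - degZero y) := by
      simp only [degZero, map_add, add_smul, Finset.sum_add_distrib]; abel
    rw [this]; exact Submodule.add_mem _ hx hy
  · have : c • x - degZero (c • x) = c • (x - degZero x) := by
      simp only [degZero, map_smul, smul_sub, Finset.smul_sum, smul_assoc]
    rw [this]; exact Submodule.smul_mem _ _ hx
  · obtain ⟨i, j, l, h⟩ := p
    cases l with
    | nil =>
      obtain rfl : i = j := h
      have : degZero (of k (⟨i, i, [], rfl⟩ : Q.Path)) = of k (⟨i, i, [], rfl⟩ : Q.Path) := by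
        rw [degZero, Finset.sum_eq_single i]
        · rw [coef_of, if_pos (by rfl), one_smul]; rfl
        · intro j _ hj
          rw [coef_of, if_neg, zero_smul]
          exact fun e => hj (congrArg FinQuiver.Path.source e).symm
        · simp
      rw [this, sub_self]
      exact Submodule.zero_mem _
    | cons a l =>
      have : degZero (of k (⟨i, j, a :: l, h⟩ : Q.Path)) = 0 := by
        refine Finset.sum_eq_zero fun m _ => ?_
        rw [coef_of, if_neg, zero_smul]
        intro e
        simpa [FinQuiver.Path.vertex] using congrArg FinQuiver.Path.arrows e
      rw [this, sub_zero]
      exact of_mem_spanOf (by simp)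

/-- The vertex part of f only rescales arrows. By `arrow_commutator_mem` the rest of f contributes
in degree at least two, so this is the whole degree-one part of δ⁰. -/
theorem arrow_commutator_vertices (c : Fin n → k) (a : Q.Arr) :
    of k (FinQuiver.Path.arrow Q a) * (∑ i, c i • of k (FinQuiver.Path.vertex Q i)) -
      (∑ i, c i • of k (FinQuiver.Path.vertex Q i)) * of k (FinQuiver.Path.arrow Q a) =
      (c (Q.src a) - c (Q.tgt a)) • of k (FinQuiver.Path.arrow Q a) := by
  simp only [Finset.mul_sum, Finset.sum_mul, mul_smul_comm, smul_mul_assoc, of_mul_vertex,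
    vertex_mul_of, smul_ite, smul_zero, FinQuiver.Path.arrow]
  rw [Finset.sum_ite_eq, Finset.sum_ite_eq, sub_smul]
  simp

theorem arrow_commutator_mem {f : PathAlg k Q} (hf : f ∈ spanOf k {p : Q.Path | p.arrows ≠ []})
    (a : Q.Arr) : of k (FinQuiver.Path.arrow Q a) * f - f * of k (FinQuiver.Path.arrow Q a) ∈
      spanOf k {p : Q.Path | 2 ≤ p.arrows.length} := by
  refine spanOf_induction (P := fun f => of k (FinQuiver.Path.arrow Q a) * f -
      f * of k (FinQuiver.Path.arrow Q a) ∈ spanOf k {p : Q.Path | 2 ≤ p.arrows.length})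
    (by simp) (fun x y hx hy => ?_) (fun c x hx => ?_) (fun p hp => ?_) hf
  · rw [mul_add, add_mul, add_sub_add_comm]; exact Submodule.add_mem _ hx hy
  · rw [mul_smul_comm, smul_mul_assoc, ← smul_sub]; exact Submodule.smul_mem _ _ hx
  · have hp' := List.length_pos_iff.2 hp
    have key : ∀ (i : Fin n) (l : List Q.Arr) (j : Fin n), 2 ≤ l.length →
        pathOrZero k Q i l j ∈ spanOf k {p : Q.Path | 2 ≤ p.arrows.length} := by
      intro i l j hl
      rw [pathOrZero]
      split_ifs with h
      · exact of_mem_spanOf hl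
      · exact Submodule.zero_mem _
    refine Submodule.sub_mem _ ?_ ?_ <;> rw [of_mul_of, mulPath] <;> split_ifs
    · exact key _ _ _ (by simp [FinQuiver.Path.arrow]; omega)
    · exact Submodule.zero_mem _
    · exact key _ _ _ (by simp [FinQuiver.Path.arrow]; omega)
    · exact Submodule.zero_mem _

end PathAlg

namespace MonomialQuiver

variable {n : ℕ} {k : Type*} [Field k]

/-! ### Degrees and substitution over a general monomial algebra. -/

section General

variable {Q : MonomialQuiver.{u} n}

theorem isBasic_arrow (a : Q.Arr) : IsBasic (FinQuiver.Path.arrow Q.toFinQuiver a : Q.Path) := by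
  intro r hr h
  have h1 := h.length_le
  have h2 := Q.two_le_length r hr
  simp only [FinQuiver.Path.arrow, List.length_singleton] at h1
  omega

theorem trunc_mem_spanOf {S : Set Q.Path} {f : PathAlg k Q.toFinQuiver}
    (hf : f ∈ PathAlg.spanOf k S) : Q.trunc k f ∈ PathAlg.spanOf k S := by
  refine PathAlg.spanOf_induction (P := fun f => Q.trunc k f ∈ PathAlg.spanOf k S) (by simp)
    (fun x y hx hy => by rw [map_add]; exact Submodule.add_mem _ hx hy)
    (fun c x hx => by rw [map_smul]; exact Submodule.smul_mem _ _ hx) (fun p hp => ?_) hf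
  rw [trunc_of]
  split_ifs
  · exact PathAlg.of_mem_spanOf hp
  · exact Submodule.zero_mem _

/-- A replacement removes one arrow of ε and inserts γ, so the new length is the sum of the two
lengths minus one. -/
theorem pair_replace_mem_degree (a b : Q.Arr) (γ ε : Q.Path)
    (h : 3 ≤ γ.arrows.length + ε.arrows.length) :
    Q.pair k b (Q.replace k ε a γ) ∈
      Finsupp.supported k k {ap : Q.Arr × Q.Path | 2 ≤ ap.2.arrows.length} := by
  rw [replace, replaceAll, map_sum, map_sum]
  refine Submodule.sum_mem _ fun i hi => ?_
  have hi' := Finset.mem_range.1 hi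
  split_ifs
  · rw [PathAlg.pathOrZero]
    split_ifs
    · rw [trunc_of]
      split_ifs with hb
      · rw [pair_of]
        refine Finsupp.single_mem_supported k 1 ?_
        simp only [Set.mem_ofPred_eq, List.length_append, List.length_take, List.length_drop]
        omega
      · simp
    · simp
  · simp

theorem br_mem_degree {x z : Q.Arr × Q.Path →₀ k}
    (hx : x ∈ Finsupp.supported k k {ap : Q.Arr × Q.Path | 1 ≤ ap.2.arrows.length})
    (hz : z ∈ Finsupp.supported k k {ap : Q.Arr × Q.Path | 2 ≤ ap.2.arrows.length}) :
    Q.br k x z ∈ Finsupp.supported k k {ap : Q.Arr × Q.Path | 2 ≤ ap.2.arrows.length} := by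
  rw [Finsupp.supported_eq_span_single] at hx
  refine Submodule.span_induction (p := fun x _ => Q.br k x z ∈ Finsupp.supported k k
      {ap : Q.Arr × Q.Path | 2 ≤ ap.2.arrows.length}) ?_ (by simp)
    (fun x y _ _ hx hy => by
      rw [map_add, LinearMap.add_apply]; exact Submodule.add_mem _ hx hy)
    (fun c x _ hx => by
      rw [map_smul, LinearMap.smul_apply]; exact Submodule.smul_mem _ _ hx) hx
  rintro _ ⟨⟨a, γ⟩, hγ, rfl⟩
  rw [Finsupp.supported_eq_span_single] at hz
  refine Submodule.span_induction (p := fun z _ => Q.br k (Finsupp.single (a, γ) 1) z ∈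
      Finsupp.supported k k {ap : Q.Arr × Q.Path | 2 ≤ ap.2.arrows.length}) ?_ (by simp)
    (fun x y _ _ hx hy => by rw [map_add]; exact Submodule.add_mem _ hx hy)
    (fun c x _ hx => by rw [map_smul]; exact Submodule.smul_mem _ _ hx) hz
  rintro _ ⟨⟨b, ε⟩, hε, rfl⟩
  simp only [Set.mem_ofPred_eq] at hγ hε
  rw [br_single]
  exact Submodule.sub_mem _ (pair_replace_mem_degree _ _ _ _ (by omega))
    (pair_replace_mem_degree _ _ _ _ (by omega))

theorem subst_of_eq_zero {x : Q.Arr × Q.Path →₀ k} (hx : x ∈ Q.C1 k) (p : Q.Path)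
    (h : ∀ a ∈ p.arrows, Q.val k a x = 0) : Q.subst k x (PathAlg.of k p) = 0 := by
  obtain ⟨i, j, l, hl⟩ := p
  induction l generalizing i with
  | nil => exact subst_vertex _ _ rfl
  | cons a l ih =>
    rw [PathAlg.of_cons, subst_mul hx, subst_arrow hx, h a (by simp),
      ih _ _ fun b hb => h b (List.mem_cons_of_mem _ hb), zero_mul, mul_zero, add_zero]

theorem val_filter (P : Q.Arr → Prop) (x : Q.Arr × Q.Path →₀ k) (a : Q.Arr) :
    Q.val k a (x.filter fun bp => P bp.1) = if P a then Q.val k a x else 0 := by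
  refine pairs_induction (P := fun x => Q.val k a (x.filter fun bp => P bp.1) =
      if P a then Q.val k a x else 0) (by rw [Finsupp.filter_zero]; simp) (fun x y hx hy => ?_) (fun c x hx => ?_)
    (fun b p => ?_) x
  · rw [Finsupp.filter_add, map_add, map_add, hx, hy]; split_ifs <;> simp
  · rw [Finsupp.filter_smul, map_smul, map_smul, hx]; split_ifs <;> simp
  · by_cases hb : P b
    · rw [Finsupp.filter_single_of_pos (fun bp : Q.Arr × Q.Path => P bp.1) hb, val_single]
      by_cases hba : b = a
      · subst hba; simp [hb]
      · simp [hba]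
    · rw [Finsupp.filter_single_of_neg (fun bp : Q.Arr × Q.Path => P bp.1) hb, map_zero, val_single]
      by_cases hba : b = a
      · subst hba; simp [hb]
      · simp [hba]

end General

/-! ### Paths of the dual extension -/

variable {B A : MonomialQuiver.{u} n}

theorem arr_cases (c : (dualExt B A).Arr) : (∃ b, c = arrB B A b) ∨ ∃ a, c = arrA B A a :=
  match c with
  | Sum.inl b => Or.inl ⟨b, rfl⟩
  | Sum.inr a => Or.inr ⟨a, rfl⟩

theorem arrB_injective : Function.Injective (arrB B A) := Sum.inl_injective

theorem arrA_ne_arrB (a : A.op.Arr) (b : B.Arr) : arrA B A a ≠ arrB B A b := Sum.inr_ne_inl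

theorem pathB_injective : Function.Injective (pathB B A) := inl_injective _ _

theorem pathB_mem_rel {r : B.Path} (hr : r ∈ B.rel) : pathB B A r ∈ (dualExt B A).rel :=
  Or.inl (Or.inl ⟨r, hr, rfl⟩)

theorem isPath_map_arrB {l : List B.Arr} {i j : Fin n} :
    (dualExt B A).IsPath i (l.map (arrB B A)) j ↔ B.IsPath i l j := by
  induction l generalizing i with
  | nil => exact Iff.rfl
  | cons b l ih => exact and_congr Iff.rfl ih

theorem le_of_isPath_map_arrA (hA : A.IsDirected) {m : List A.op.Arr} {i j : Fin n}
    (h : (dualExt B A).IsPath i (m.map (arrA B A)) j) : j ≤ i := by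
  induction m generalizing i with
  | nil => exact le_of_eq (Eq.symm h)
  | cons a m ih =>
    obtain ⟨rfl, h⟩ := h
    exact (ih h).trans (hA a).le

theorem mem_range_pathB {p : (dualExt B A).Path} :
    p ∈ Set.range (pathB B A) ↔ ∀ c ∈ p.arrows, ∃ b, c = arrB B A b := by
  constructor
  · rintro ⟨q, rfl⟩ c hc
    obtain ⟨b, _, rfl⟩ := List.mem_map.1 hc
    exact ⟨b, rfl⟩
  · intro h
    have h' : p.arrows ∈ Set.range (List.map (arrB B A)) := by
      rw [Set.range_list_map]
      intro c hc
      obtain ⟨b, rfl⟩ := h c hc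
      exact ⟨b, rfl⟩
    obtain ⟨l, hl⟩ := h'
    obtain ⟨i, j, m, hm⟩ := p
    simp only at hl
    subst hl
    exact ⟨⟨i, j, l, isPath_map_arrB.1 hm⟩, rfl⟩

/-- Every relation of Λ that does not come from B contains an arrow of Aᵒᵖ, so it cannot occur in a
path of B. -/
theorem isBasic_pathB {q : B.Path} : IsBasic (pathB B A q) ↔ IsBasic q := by
  constructor
  · intro h r hr hrq
    refine h (pathB B A r) (pathB_mem_rel hr) ?_
    obtain ⟨s, t, hst⟩ := hrq
    refine ⟨s.map (arrB B A), t.map (arrB B A), ?_⟩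
    change s.map (arrB B A) ++ r.arrows.map (arrB B A) ++ t.map (arrB B A) =
      q.arrows.map (arrB B A)
    rw [← hst, List.map_append, List.map_append]
  · rintro h _ ((⟨r, hr, rfl⟩ | ⟨r, hr, rfl⟩) | ⟨α, β, h', rfl⟩) hrq
    · exact h r hr (map_infix_map Sum.inl_injective hrq)
    · have h2 := A.op.two_le_length r hr
      obtain ⟨a, l, hl⟩ := List.exists_cons_of_length_pos (by omega : 0 < r.arrows.length)
      have := hrq.subset (show Sum.inr a ∈ (FinQuiver.Path.inr B.toFinQuiver r).arrows by
        simp [FinQuiver.Path.inr, hl])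
      obtain ⟨b, _, hb⟩ := List.mem_map.1 this
      exact absurd hb Sum.inl_ne_inr
    · have := hrq.subset (show Sum.inr β ∈
        (mixedRel B.toFinQuiver A.op.toFinQuiver α β h').arrows by simp [mixedRel])
      obtain ⟨b, _, hb⟩ := List.mem_map.1 this
      exact absurd hb Sum.inl_ne_inr

/-- A path in `ℬ_Λ` is a path of `B` followed by a path of `Aᵒᵖ`. -/
theorem exists_eq_append_of_isBasic {p : (dualExt B A).Path} (hp : IsBasic p) :
    ∃ (l : List B.Arr) (m : List A.op.Arr),
      p.arrows = l.map (arrB B A) ++ m.map (arrA B A) := by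
  obtain ⟨i, j, L, hL⟩ := p
  induction L generalizing i with
  | nil => exact ⟨[], [], rfl⟩
  | cons c L ih =>
    obtain ⟨l, m, hlm⟩ := ih _ hL.2 fun r hr h => hp r hr (h.trans (List.suffix_cons _ _).isInfix)
    simp only at hlm
    rcases arr_cases c with ⟨b, rfl⟩ | ⟨a, rfl⟩
    · exact ⟨b :: l, m, by simp [hlm]⟩
    · cases l with
      | nil => exact ⟨[], a :: m, by simp [hlm]⟩
      | cons b l =>
        exfalso
        subst hlm
        -- An arrow of Aᵒᵖ directly followed by an arrow of B is a mixed relation.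
        refine hp (mixedRel B.toFinQuiver A.op.toFinQuiver b a hL.2.1.symm)
          (Or.inr ⟨_, _, _, rfl⟩) ?_
        exact (List.prefix_append [arrA B A a, arrB B A b] _).isInfix

/-- A path in `ℬ` parallel to an arrow of `B` starts with an arrow of `B`. -/
theorem exists_eq_cons_append (hA : A.IsDirected) (hB : B.IsDirected) {p : (dualExt B A).Path}
    (hp : IsBasic p) {b : B.Arr} (hs : p.source = B.src b) (ht : p.target = B.tgt b) :
    ∃ (b' : B.Arr) (l : List B.Arr) (m : List A.op.Arr),
      p.arrows = (b' :: l).map (arrB B A) ++ m.map (arrA B A) := by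
  obtain ⟨l, m, h⟩ := exists_eq_append_of_isBasic hp
  cases l with
  | nil =>
    -- A path inside Aᵒᵖ never increases the vertex, while b strictly increases it.
    exfalso
    have hp := p.isPath
    rw [h] at hp
    have := le_of_isPath_map_arrA hA hp
    rw [hs, ht] at this
    exact absurd this (not_le.2 (hB b))
  | cons b' l => exact ⟨b', l, m, h⟩

theorem src_ne_tgt (hA : A.IsDirected) (hB : B.IsDirected) (c : (dualExt B A).Arr) :
    (dualExt B A).src c ≠ (dualExt B A).tgt c := by
  rcases arr_cases c with ⟨b, rfl⟩ | ⟨a, rfl⟩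
  · exact (hB b).ne
  · exact (hA a).ne'

/-! ### Embedding of, and projection onto, the path algebra of `B` -/

variable (k B A) in
/-- The inclusion of path algebras. -/
def inclB : PathAlg k B.toFinQuiver →ₗ[k] PathAlg k (dualExt B A).toFinQuiver :=
  PathAlg.lift fun p => PathAlg.of k (pathB B A p)

variable (k B A) in
/-- The projection of path algebras that kills the arrows of `Aᵒᵖ`. -/
def resB : PathAlg k (dualExt B A).toFinQuiver →ₗ[k] PathAlg k B.toFinQuiver :=
  PathAlg.lift (M := PathAlg k B.toFinQuiver) fun p =>
    if h : p ∈ Set.range (pathB B A) then PathAlg.of k h.choose else 0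

theorem inclB_of (p : B.Path) :
    inclB k B A (PathAlg.of k p) = PathAlg.of k (pathB B A p) := PathAlg.lift_of _ _

theorem resB_of_pathB (p : B.Path) : resB k B A (PathAlg.of k (pathB B A p)) = PathAlg.of k p := by
  have h : pathB B A p ∈ Set.range (pathB B A) := ⟨p, rfl⟩
  rw [resB, PathAlg.lift_of, dif_pos h, pathB_injective h.choose_spec]

theorem resB_of_notMem {p : (dualExt B A).Path} (h : p ∉ Set.range (pathB B A)) :
    resB k B A (PathAlg.of k p) = 0 := by
  rw [resB, PathAlg.lift_of, dif_neg h]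

theorem resB_inclB (f : PathAlg k B.toFinQuiver) : resB k B A (inclB k B A f) = f := by
  refine PathAlg.induction_paths (P := fun f => resB k B A (inclB k B A f) = f) (by simp)
    (fun x y hx hy => by rw [map_add, map_add, hx, hy])
    (fun c x hx => by rw [map_smul, map_smul, hx]) (fun p => ?_) f
  rw [inclB_of, resB_of_pathB]

theorem inclB_mul (f g : PathAlg k B.toFinQuiver) :
    inclB k B A (f * g) = inclB k B A f * inclB k B A g := by
  refine PathAlg.induction_paths (P := fun f => inclB k B A (f * g) =
      inclB k B A f * inclB k B A g) (by simp)
    (fun x y hx hy => by simp only [add_mul, map_add, hx, hy])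
    (fun c x hx => by simp only [smul_mul_assoc, map_smul, hx]) (fun p => ?_) f
  refine PathAlg.induction_paths (P := fun g => inclB k B A (PathAlg.of k p * g) =
      inclB k B A (PathAlg.of k p) * inclB k B A g) (by simp)
    (fun x y hx hy => by simp only [mul_add, map_add, hx, hy])
    (fun c x hx => by simp only [mul_smul_comm, map_smul, hx]) (fun q => ?_) g
  rw [inclB_of, inclB_of]
  by_cases h : q.target = p.source
  · obtain ⟨i, j, l, hl⟩ := p
    obtain ⟨i', j', l', hl'⟩ := q
    obtain rfl : j' = i := h
    rw [PathAlg.of_mul_of_comp, inclB_of]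
    refine Eq.trans ?_ (PathAlg.of_mul_of_comp (k := k) (Q := (dualExt B A).toFinQuiver)
      (isPath_map_arrB.2 hl') (isPath_map_arrB.2 hl)).symm
    congr 1
    exact FinQuiver.Path.ext rfl rfl List.map_append
  · rw [PathAlg.of_mul_of_ne h, map_zero]
    exact (PathAlg.of_mul_of_ne (Q := (dualExt B A).toFinQuiver) h).symm

theorem resB_of_mul_of_eq_zero {p q : (dualExt B A).Path}
    (h : ¬ ∀ c ∈ q.arrows ++ p.arrows, ∃ b, c = arrB B A b) :
    resB k B A (PathAlg.of k p * PathAlg.of k q) = 0 := by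
  rw [PathAlg.of_mul_of, PathAlg.mulPath, PathAlg.pathOrZero]
  split_ifs with h1 h2
  · exact resB_of_notMem fun h3 => h (mem_range_pathB.1 h3)
  · exact map_zero _
  · exact map_zero _

/-- The paths using an arrow of Aᵒᵖ span a two-sided ideal of kQ_Λ, and kQ_B is a complementary
subalgebra. -/
theorem resB_mul (f g : PathAlg k (dualExt B A).toFinQuiver) :
    resB k B A (f * g) = resB k B A f * resB k B A g := by
  refine PathAlg.induction_paths (P := fun f => resB k B A (f * g) =
      resB k B A f * resB k B A g) (by simp)
    (fun x y hx hy => by simp only [add_mul, map_add, hx, hy])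
    (fun c x hx => by simp only [smul_mul_assoc, map_smul, hx]) (fun p => ?_) f
  refine PathAlg.induction_paths (P := fun g => resB k B A (PathAlg.of k p * g) =
      resB k B A (PathAlg.of k p) * resB k B A g) (by simp)
    (fun x y hx hy => by simp only [mul_add, map_add, hx, hy])
    (fun c x hx => by simp only [mul_smul_comm, map_smul, hx]) (fun q => ?_) g
  by_cases hp : p ∈ Set.range (pathB B A)
  · by_cases hq : q ∈ Set.range (pathB B A)
    · obtain ⟨p, rfl⟩ := hp
      obtain ⟨q, rfl⟩ := hq
      rw [resB_of_pathB, resB_of_pathB, ← inclB_of, ← inclB_of, ← inclB_mul, resB_inclB]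
    · rw [resB_of_notMem hq, mul_zero]
      exact resB_of_mul_of_eq_zero fun h => hq (mem_range_pathB.2 fun c hc =>
        h c (List.mem_append_left _ hc))
  · rw [resB_of_notMem hp, zero_mul]
    exact resB_of_mul_of_eq_zero fun h => hp (mem_range_pathB.2 fun c hc =>
      h c (List.mem_append_right _ hc))

theorem trunc_inclB (f : PathAlg k B.toFinQuiver) :
    (dualExt B A).trunc k (inclB k B A f) = inclB k B A (B.trunc k f) := by
  refine PathAlg.induction_paths (P := fun f => (dualExt B A).trunc k (inclB k B A f) =
      inclB k B A (B.trunc k f)) (by simp)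
    (fun x y hx hy => by simp only [map_add, hx, hy])
    (fun c x hx => by simp only [map_smul, hx]) (fun p => ?_) f
  rw [inclB_of, trunc_of, trunc_of]
  simp only [isBasic_pathB]
  split_ifs
  · rw [inclB_of]
  · rw [map_zero]

theorem resB_trunc (f : PathAlg k (dualExt B A).toFinQuiver) :
    resB k B A ((dualExt B A).trunc k f) = B.trunc k (resB k B A f) := by
  refine PathAlg.induction_paths (P := fun f => resB k B A ((dualExt B A).trunc k f) =
      B.trunc k (resB k B A f)) (by simp)
    (fun x y hx hy => by simp only [map_add, hx, hy])
    (fun c x hx => by simp only [map_smul, hx]) (fun p => ?_) f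
  by_cases hp : p ∈ Set.range (pathB B A)
  · obtain ⟨p, rfl⟩ := hp
    rw [← inclB_of, trunc_inclB, resB_inclB, resB_inclB]
  · rw [resB_of_notMem hp, trunc_of, map_zero]
    split_ifs
    · exact resB_of_notMem hp
    · exact map_zero _

theorem resB_arrow (b : B.Arr) :
    resB k B A (PathAlg.of k (FinQuiver.Path.arrow (dualExt B A).toFinQuiver (arrB B A b))) =
      PathAlg.of k (FinQuiver.Path.arrow B.toFinQuiver b) :=
  resB_of_pathB (FinQuiver.Path.arrow B.toFinQuiver b)

theorem resB_arrA (a : A.op.Arr) :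
    resB k B A (PathAlg.of k (FinQuiver.Path.arrow (dualExt B A).toFinQuiver (arrA B A a))) =
      0 := by
  refine resB_of_notMem fun h => ?_
  obtain ⟨b, hb⟩ := mem_range_pathB.1 h (arrA B A a) (by simp [FinQuiver.Path.arrow])
  exact arrA_ne_arrB a b hb

theorem inclB_arrow (b : B.Arr) :
    inclB k B A (PathAlg.of k (FinQuiver.Path.arrow B.toFinQuiver b)) =
      PathAlg.of k (FinQuiver.Path.arrow (dualExt B A).toFinQuiver (arrB B A b)) :=
  inclB_of _

/-! ### The projection of `Ker δ¹` -/

theorem projB_apply (x : (dualExt B A).Arr × (dualExt B A).Path →₀ k) (b : B.Arr) (q : B.Path) :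
    projB k B A x (b, q) = x (arrB B A b, pathB B A q) := rfl

/-- Expresses the projection of pairs through `resB`, whose multiplicativity then drives the proofs
about Ker δ¹. -/
theorem val_projB (x : (dualExt B A).Arr × (dualExt B A).Path →₀ k) (b : B.Arr) :
    B.val k b (projB k B A x) = resB k B A ((dualExt B A).val k (arrB B A b) x) := by
  refine pairs_induction (P := fun x => B.val k b (projB k B A x) =
      resB k B A ((dualExt B A).val k (arrB B A b) x)) (by simp)
    (fun x y hx hy => by simp only [map_add, hx, hy])
    (fun c x hx => by simp only [map_smul, hx]) (fun c p => ?_) x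
  rw [val_single]
  by_cases h : (c, p) ∈ Set.range (Prod.map (arrB B A) (pathB B A))
  · obtain ⟨⟨b', q⟩, h⟩ := h
    obtain ⟨rfl, rfl⟩ := Prod.ext_iff.1 h
    have e : projB k B A (Finsupp.single (arrB B A b', pathB B A q) 1) =
        Finsupp.single (b', q) 1 :=
      Finsupp.comapDomain_single (Prod.map (arrB B A) (pathB B A)) (b', q) (1 : k) _
    change B.val k b (projB k B A (Finsupp.single (arrB B A b', pathB B A q) 1)) =
      resB k B A (if arrB B A b' = arrB B A b then PathAlg.of k (pathB B A q) else 0)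
    rw [e, val_single]
    simp only [arrB_injective.eq_iff]
    split_ifs
    · rw [resB_of_pathB]
    · rw [map_zero]
  · have e : projB k B A (Finsupp.single (c, p) 1) = 0 :=
      Finsupp.comapDomain_single_of_not_mem_range h _ _
    rw [e, map_zero]
    split_ifs with hc
    · subst hc
      rw [resB_of_notMem]
      rintro ⟨q, rfl⟩
      exact h ⟨(b, q), rfl⟩
    · rw [map_zero]

theorem projB_mem_C1 {x : (dualExt B A).Arr × (dualExt B A).Path →₀ k}
    (hx : x ∈ (dualExt B A).C1 k) : projB k B A x ∈ B.C1 k := by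
  rw [C1, Finsupp.mem_supported'] at hx ⊢
  rintro ⟨b, q⟩ h
  rw [projB_apply]
  refine hx _ fun h' => h ?_
  exact ⟨isBasic_pathB.1 h'.1, h'.2⟩

/-- Paths of B do not decrease the vertex and arrows of Aᵒᵖ strictly decrease it, so no path of B is
parallel to an arrow of Aᵒᵖ. -/
theorem resB_val_arrA (hA : A.IsDirected) (hB : B.IsDirected)
    {x : (dualExt B A).Arr × (dualExt B A).Path →₀ k} (hx : x ∈ (dualExt B A).C1 k)
    (a : A.op.Arr) : resB k B A ((dualExt B A).val k (arrA B A a) x) = 0 := by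
  refine PathAlg.spanOf_induction (P := fun f => resB k B A f = 0) (by simp)
    (fun x y hx hy => by rw [map_add, hx, hy, add_zero])
    (fun c x hx => by rw [map_smul, hx, smul_zero]) (fun p hp => ?_) (mem_C1_iff_val.1 hx _)
  refine resB_of_notMem ?_
  rintro ⟨q, rfl⟩
  have h := hB.le_of_isPath q.isPath
  have h1 : q.source = A.tgt a := hp.2.1
  have h2 : q.target = A.src a := hp.2.2
  rw [h1, h2] at h
  exact absurd h (not_le.2 (hA a))

/-- Both sides obey the Leibniz rule along `resB`, so vertices and arrows suffice. On an arrow of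
Aᵒᵖ both sides vanish, the left one by directedness. -/
theorem resB_subst (hA : A.IsDirected) (hB : B.IsDirected)
    {x : (dualExt B A).Arr × (dualExt B A).Path →₀ k} (hx : x ∈ (dualExt B A).C1 k)
    (f : PathAlg k (dualExt B A).toFinQuiver) :
    resB k B A ((dualExt B A).subst k x f) = B.subst k (projB k B A x) (resB k B A f) := by
  refine PathAlg.induction_arrows (P := fun f => resB k B A ((dualExt B A).subst k x f) =
      B.subst k (projB k B A x) (resB k B A f)) (by simp)
    (fun x y hx hy => by simp only [map_add, hx, hy])
    (fun c x hx => by simp only [map_smul, hx]) (fun i => ?_) (fun c => ?_)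
    (fun f g hf hg => ?_) f
  · rw [subst_vertex _ _ rfl, map_zero]
    have e : resB k B A (PathAlg.of k (FinQuiver.Path.vertex (dualExt B A).toFinQuiver i)) =
        PathAlg.of k (FinQuiver.Path.vertex B.toFinQuiver i) :=
      resB_of_pathB (FinQuiver.Path.vertex B.toFinQuiver i)
    rw [e, subst_vertex _ _ rfl]
  · rw [subst_arrow hx]
    rcases arr_cases c with ⟨b, rfl⟩ | ⟨a, rfl⟩
    · rw [resB_arrow, subst_arrow (projB_mem_C1 hx), val_projB]
    · rw [resB_arrA, map_zero, resB_val_arrA hA hB hx]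
  · rw [subst_mul hx, map_add, resB_mul, resB_mul, resB_mul, subst_mul (projB_mem_C1 hx), hf, hg]

theorem projB_mem_kerDelta1 (hA : A.IsDirected) (hB : B.IsDirected)
    {x : (dualExt B A).Arr × (dualExt B A).Path →₀ k} (hx : x ∈ (dualExt B A).kerDelta1 k) :
    projB k B A x ∈ B.kerDelta1 k := by
  refine mem_kerDelta1_of (projB_mem_C1 hx.1) fun r hr => ?_
  rw [← resB_of_pathB (A := A) r, ← resB_subst hA hB hx.1, ← resB_trunc,
    trunc_subst_rel hx (pathB_mem_rel hr), map_zero]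

variable (k) in
/-- The projection `Ker δ¹_Λ → Ker δ¹_B`. -/
def projKer (hA : A.IsDirected) (hB : B.IsDirected) :
    (dualExt B A).kerDelta1 k →ₗ⁅k⁆ B.kerDelta1 k where
  toFun x := ⟨projB k B A x.1, projB_mem_kerDelta1 hA hB x.2⟩
  map_add' x y := Subtype.ext (map_add _ _ _)
  map_smul' c x := Subtype.ext (map_smul _ _ _)
  map_lie' := by
    intro x y
    refine Subtype.ext (val_ext fun b => ?_)
    change B.val k b (projB k B A ((dualExt B A).br k x.1 y.1)) =
      B.val k b (B.br k (projB k B A x.1) (projB k B A y.1))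
    rw [val_br, val_projB, val_br, map_sub, resB_trunc, resB_trunc, resB_subst hA hB x.2.1,
      resB_subst hA hB y.2.1, val_projB, val_projB]

/-! ### Elements of `Ker δ¹` concentrated on the arrows of `B` -/

/-- Relations of Aᵒᵖ contain only arrows where x vanishes. A mixed relation αβ becomes x(α)β, and it
dies because every path in x(α) starts with an arrow of B. Only the relations of B impose a
condition. -/
theorem mem_kerDelta1_of_arrB (hA : A.IsDirected) (hB : B.IsDirected)
    {x : (dualExt B A).Arr × (dualExt B A).Path →₀ k} (hx : x ∈ (dualExt B A).C1 k)
    (h0 : ∀ a, (dualExt B A).val k (arrA B A a) x = 0)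
    (h : ∀ r ∈ B.rel, (dualExt B A).trunc k
      ((dualExt B A).subst k x (PathAlg.of k (pathB B A r))) = 0) :
    x ∈ (dualExt B A).kerDelta1 k := by
  refine mem_kerDelta1_of hx ?_
  rintro _ ((⟨r, hr, rfl⟩ | ⟨r, hr, rfl⟩) | ⟨α, β, h', rfl⟩)
  · exact h r hr
  · refine (congrArg _ (subst_of_eq_zero hx _ ?_)).trans (map_zero _)
    intro c hc
    obtain ⟨a, _, rfl⟩ := List.mem_map.1 hc
    exact h0 a
  · have e : (PathAlg.of k (mixedRel B.toFinQuiver A.op.toFinQuiver α β h') :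
        PathAlg k (dualExt B A).toFinQuiver) =
        PathAlg.of k (FinQuiver.Path.arrow (dualExt B A).toFinQuiver (arrB B A α)) *
          PathAlg.of k (FinQuiver.Path.arrow (dualExt B A).toFinQuiver (arrA B A β)) := by
      refine Eq.trans (PathAlg.of_cons (Q := (dualExt B A).toFinQuiver)
        (mixedRel B.toFinQuiver A.op.toFinQuiver α β h').isPath) ?_
      congr 2
      exact FinQuiver.Path.ext h' rfl rfl
    rw [e, subst_mul hx, subst_arrow hx, subst_arrow hx, h0, mul_zero, add_zero]
    refine PathAlg.spanOf_induction (P := fun f => (dualExt B A).trunc k (f * PathAlg.of k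
        (FinQuiver.Path.arrow (dualExt B A).toFinQuiver (arrA B A β))) = 0) (by simp)
      (fun x y hx hy => by rw [add_mul, map_add, hx, hy, add_zero])
      (fun c x hx => by rw [smul_mul_assoc, map_smul, hx, smul_zero]) (fun p hp => ?_)
      (mem_C1_iff_val.1 hx _)
    obtain ⟨b, l, m, hlm⟩ := exists_eq_cons_append hA hB hp.1 hp.2.1 hp.2.2
    rw [of_mul_of_arrow, PathAlg.pathOrZero]
    split_ifs with h1 h2
    · rw [trunc_of, if_neg]
      intro hb
      -- If the composite were basic, all its arrows of B would precede those of Aᵒᵖ, but it begins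
      -- with β followed by an arrow of B.
      obtain ⟨l', m', e'⟩ := exists_eq_append_of_isBasic hb
      simp only [hlm] at e'
      cases l' with
      | nil =>
        have : arrB B A b ∈ m'.map (arrA B A) := by
          have h3 : arrB B A b ∈ ([] : List B.Arr).map (arrB B A) ++ m'.map (arrA B A) := by
            rw [← e']; simp
          simpa using h3
        obtain ⟨a, _, ha⟩ := List.mem_map.1 this
        exact arrA_ne_arrB _ _ ha
      | cons b' l' =>
        simp only [List.map_cons, List.cons_append, List.cons.injEq] at e'
        exact arrA_ne_arrB _ _ e'.1
    · exact map_zero _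
    · exact map_zero _

variable (k B A) in
/-- The inclusion of `k((Q_B)₁//ℬ_B)` in `k((Q_Λ)₁//ℬ_Λ)`. -/
def inclPairs : (B.Arr × B.Path →₀ k) →ₗ[k] ((dualExt B A).Arr × (dualExt B A).Path →₀ k) :=
  Finsupp.lmapDomain k k (Prod.map (arrB B A) (pathB B A))

theorem projB_inclPairs (y : B.Arr × B.Path →₀ k) : projB k B A (inclPairs k B A y) = y :=
  Finsupp.comapDomain_mapDomain _ (arrB_injective.prodMap pathB_injective) y

theorem inclPairs_single (b : B.Arr) (p : B.Path) :
    inclPairs k B A (Finsupp.single (b, p) 1) =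
      Finsupp.single (arrB B A b, pathB B A p) 1 := Finsupp.mapDomain_single

theorem val_inclPairs_arrB (y : B.Arr × B.Path →₀ k) (b : B.Arr) :
    (dualExt B A).val k (arrB B A b) (inclPairs k B A y) = inclB k B A (B.val k b y) := by
  refine pairs_induction (P := fun y => (dualExt B A).val k (arrB B A b) (inclPairs k B A y) =
      inclB k B A (B.val k b y)) (by simp)
    (fun x y hx hy => by simp only [map_add, hx, hy])
    (fun c x hx => by simp only [map_smul, hx]) (fun c p => ?_) y
  rw [inclPairs_single, val_single, val_single]
  simp only [arrB_injective.eq_iff]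
  split_ifs
  · rw [inclB_of]
  · rw [map_zero]

theorem val_inclPairs_arrA (y : B.Arr × B.Path →₀ k) (a : A.op.Arr) :
    (dualExt B A).val k (arrA B A a) (inclPairs k B A y) = 0 := by
  refine pairs_induction (P := fun y => (dualExt B A).val k (arrA B A a) (inclPairs k B A y) = 0)
    (by simp) (fun x y hx hy => by simp only [map_add, hx, hy, add_zero])
    (fun c x hx => by simp only [map_smul, hx, smul_zero]) (fun c p => ?_) y
  rw [inclPairs_single, val_single, if_neg (arrA_ne_arrB a c).symm]

theorem inclPairs_mem_C1 {y : B.Arr × B.Path →₀ k} (hy : y ∈ B.C1 k) :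
    inclPairs k B A y ∈ (dualExt B A).C1 k := by
  refine C1_induction (P := fun y => inclPairs k B A y ∈ (dualExt B A).C1 k) (by simp)
    (fun x y hx hy => by rw [map_add]; exact Submodule.add_mem _ hx hy)
    (fun c x hx => by rw [map_smul]; exact Submodule.smul_mem _ _ hx)
    (fun b p h1 h2 h3 => ?_) hy
  rw [inclPairs_single]
  exact Finsupp.single_mem_supported k 1 ⟨isBasic_pathB.2 h1, h2, h3⟩

theorem subst_inclPairs {y : B.Arr × B.Path →₀ k} (hy : y ∈ B.C1 k)
    (f : PathAlg k B.toFinQuiver) :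
    (dualExt B A).subst k (inclPairs k B A y) (inclB k B A f) =
      inclB k B A (B.subst k y f) := by
  refine PathAlg.induction_arrows (P := fun f => (dualExt B A).subst k (inclPairs k B A y)
      (inclB k B A f) = inclB k B A (B.subst k y f)) (by simp)
    (fun x y hx hy => by simp only [map_add, hx, hy])
    (fun c x hx => by simp only [map_smul, hx]) (fun i => ?_) (fun b => ?_)
    (fun f g hf hg => ?_) f
  · rw [inclB_of, subst_vertex _ _ rfl, subst_vertex _ _ rfl, map_zero]
  · rw [inclB_arrow, subst_arrow hy, subst_arrow (inclPairs_mem_C1 hy), val_inclPairs_arrB]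
  · rw [inclB_mul, subst_mul (inclPairs_mem_C1 hy), subst_mul hy, map_add, inclB_mul, inclB_mul,
      hf, hg]

/-- On relations of B the substitution is the one computed in kQ_B. This provides a section of the
projection on Ker δ¹. -/
theorem inclPairs_mem_kerDelta1 (hA : A.IsDirected) (hB : B.IsDirected)
    {y : B.Arr × B.Path →₀ k} (hy : y ∈ B.kerDelta1 k) :
    inclPairs k B A y ∈ (dualExt B A).kerDelta1 k := by
  refine mem_kerDelta1_of_arrB hA hB (inclPairs_mem_C1 hy.1) (val_inclPairs_arrA y)
    fun r hr => ?_
  rw [← inclB_of, subst_inclPairs hy.1, trunc_inclB, trunc_subst_rel hy hr, map_zero]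

theorem projKer_surjective (hA : A.IsDirected) (hB : B.IsDirected) :
    Function.Surjective (projKer k hA hB) := fun y =>
  ⟨⟨inclPairs k B A y.1, inclPairs_mem_kerDelta1 hA hB y.2⟩, Subtype.ext (projB_inclPairs y.1)⟩

/-! ### The ideal `𝒥` -/

/-- Elements of 𝒥' vanish on the arrows of Aᵒᵖ, elements of the other summand on those of B. -/
theorem disjoint_idealJ'_kerRel : Disjoint (idealJ' k B A) (kerRel k B A) := by
  rw [Submodule.disjoint_def]
  intro x hx hx'
  refine val_ext fun c => ?_
  rw [map_zero]
  rcases arr_cases c with ⟨b, rfl⟩ | ⟨a, rfl⟩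
  · exact LinearMap.mem_ker.1 ((Submodule.mem_iInf _).1 hx'.2 b)
  · have h := mem_supported_iff_val.1 hx.2 (arrA B A a)
    have e : {p : (dualExt B A).Path | (arrA B A a, p) ∈
        {ap : (dualExt B A).Arr × (dualExt B A).Path |
          (∃ b, ap.1 = arrB B A b) ∧ IsBasic ap.2 ∧ IsMixed ap.2}} = ∅ := by
      ext p
      simp only [Set.mem_ofPred_eq, Set.mem_empty_iff_false, iff_false]
      rintro ⟨⟨b, hb⟩, _⟩
      exact arrA_ne_arrB a b hb
    rw [e] at h
    simpa [PathAlg.spanOf] using h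

/-- The arrow is an arrow of `B`. -/
def IsArrB (c : (dualExt B A).Arr) : Prop := ∃ b, c = arrB B A b

/-- The terms `b//p` of an element with `b` an arrow of `B`. -/
def restrictB (x : (dualExt B A).Arr × (dualExt B A).Path →₀ k) :
    (dualExt B A).Arr × (dualExt B A).Path →₀ k :=
  x.filter fun cp => IsArrB cp.1

theorem val_restrictB_arrB (x : (dualExt B A).Arr × (dualExt B A).Path →₀ k) (b : B.Arr) :
    (dualExt B A).val k (arrB B A b) (restrictB x) = (dualExt B A).val k (arrB B A b) x :=
  (val_filter IsArrB x _).trans (if_pos ⟨b, rfl⟩)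

theorem val_restrictB_arrA (x : (dualExt B A).Arr × (dualExt B A).Path →₀ k) (a : A.op.Arr) :
    (dualExt B A).val k (arrA B A a) (restrictB x) = 0 :=
  (val_filter IsArrB x _).trans
    (if_neg fun ⟨b, hb⟩ => arrA_ne_arrB a b hb)

theorem restrictB_mem_C1 {x : (dualExt B A).Arr × (dualExt B A).Path →₀ k}
    (hx : x ∈ (dualExt B A).C1 k) : restrictB x ∈ (dualExt B A).C1 k := by
  rw [C1, Finsupp.mem_supported'] at hx ⊢
  intro cp h
  rw [restrictB, Finsupp.filter_apply, hx cp h, ite_self]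

/-- A relation of B contains only arrows of B, so x and its restriction agree on it. -/
theorem restrictB_mem_kerDelta1 (hA : A.IsDirected) (hB : B.IsDirected)
    {x : (dualExt B A).Arr × (dualExt B A).Path →₀ k} (hx : x ∈ (dualExt B A).kerDelta1 k) :
    restrictB x ∈ (dualExt B A).kerDelta1 k := by
  have h1 := restrictB_mem_C1 hx.1
  refine mem_kerDelta1_of_arrB hA hB h1 (val_restrictB_arrA x) fun r hr => ?_
  have h2 : (dualExt B A).subst k (x - restrictB x) (PathAlg.of k (pathB B A r)) = 0 := by
    refine subst_of_eq_zero (Submodule.sub_mem _ hx.1 h1) _ fun c hc => ?_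
    obtain ⟨b, _, rfl⟩ := List.mem_map.1 hc
    rw [map_sub]
    exact sub_eq_zero.2 (val_restrictB_arrB x b).symm
  rw [map_sub, LinearMap.sub_apply, sub_eq_zero] at h2
  rw [← h2]
  exact trunc_subst_rel hx (pathB_mem_rel hr)

theorem projB_eq_zero_of_mem_idealJ {x : (dualExt B A).Arr × (dualExt B A).Path →₀ k}
    (hx : x ∈ idealJ k B A) : projB k B A x = 0 := by
  obtain ⟨y, hy, z, hz, rfl⟩ := Submodule.mem_sup.1 hx
  rw [map_add]
  have h1 : projB k B A y = 0 := by
    ext ⟨b, q⟩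
    rw [projB_apply]
    refine (Finsupp.mem_supported' _ _).1 hy.2 _ ?_
    rintro ⟨_, _, l, m, _, hm, e⟩
    obtain ⟨a, m', rfl⟩ := List.exists_cons_of_ne_nil hm
    have : arrA B A a ∈ (pathB B A q).arrows := by rw [e]; simp
    obtain ⟨b', _, hb'⟩ := List.mem_map.1 this
    exact arrA_ne_arrB a b' hb'.symm
  have h2 : projB k B A z = 0 := by
    refine val_ext fun b => ?_
    rw [val_projB, LinearMap.mem_ker.1 ((Submodule.mem_iInf _).1 hz.2 b), map_zero, map_zero]
  rw [h1, h2, add_zero]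

/-- The decomposition is `restrictB x` plus the rest. The rest vanishes on the arrows of B by
construction; the work is to see that only mixed paths occur in `restrictB x`. -/
theorem mem_idealJ_iff (hA : A.IsDirected) (hB : B.IsDirected)
    {x : (dualExt B A).Arr × (dualExt B A).Path →₀ k} (hx : x ∈ (dualExt B A).kerDelta1 k) :
    x ∈ idealJ k B A ↔ projB k B A x = 0 := by
  refine ⟨projB_eq_zero_of_mem_idealJ, fun h => ?_⟩
  have hk := restrictB_mem_kerDelta1 hA hB hx
  rw [← add_sub_cancel (restrictB x) x]
  refine Submodule.add_mem_sup ⟨hk, ?_⟩ ⟨Submodule.sub_mem _ hx hk, ?_⟩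
  · change restrictB x ∈ Finsupp.supported k k _
    rw [Finsupp.mem_supported']
    rintro ⟨c, p⟩ hcp
    rw [restrictB, Finsupp.filter_apply]
    split_ifs with hc
    swap
    · rfl
    by_contra hne
    obtain ⟨b, rfl⟩ := hc
    have hC := (Finsupp.mem_supported k x).1 hx.1
    obtain ⟨h1, h2, h3⟩ := hC (Finsupp.mem_support_iff.2 hne)
    obtain ⟨b', l, m, e⟩ := exists_eq_cons_append hA hB h1 h2 h3
    refine hcp ⟨⟨b, rfl⟩, h1, b' :: l, m, List.cons_ne_nil _ _, ?_, e⟩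
    -- Without arrows of Aᵒᵖ the path lies in B, so its coefficient in x is a coefficient of `projB
    -- x`, hence zero.
    rintro rfl
    have hp : p ∈ Set.range (pathB B A) := by
      rw [mem_range_pathB]
      intro c hc
      rw [e] at hc
      simp only [List.map_nil, List.append_nil] at hc
      obtain ⟨b'', _, rfl⟩ := List.mem_map.1 hc
      exact ⟨b'', rfl⟩
    obtain ⟨q, rfl⟩ := hp
    apply hne
    rw [← projB_apply, h]
    rfl
  · refine (Submodule.mem_iInf _).2 fun b => LinearMap.mem_ker.2 ?_
    rw [map_sub, val_restrictB_arrB, sub_self]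

/-! ### The ideal `ℐ` -/

/-- A directed quiver has no oriented cycle of positive length, so only the vertices survive in
kQ_B. -/
theorem resB_cyclic (hB : B.IsDirected) {f : PathAlg k (dualExt B A).toFinQuiver}
    (hf : f ∈ PathAlg.spanOf k (dualExt B A).cyclicBasic) :
    resB k B A f = ∑ i, PathAlg.coef k (FinQuiver.Path.vertex (dualExt B A).toFinQuiver i) f •
      PathAlg.of k (FinQuiver.Path.vertex B.toFinQuiver i) := by
  refine PathAlg.spanOf_induction (P := fun f => resB k B A f =
      ∑ i, PathAlg.coef k (FinQuiver.Path.vertex (dualExt B A).toFinQuiver i) f •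
        PathAlg.of k (FinQuiver.Path.vertex B.toFinQuiver i)) (by simp)
    (fun x y hx hy => by simp only [map_add, hx, hy, add_smul, Finset.sum_add_distrib])
    (fun c x hx => by simp only [map_smul, hx, Finset.smul_sum, smul_assoc])
    (fun p hp => ?_) hf
  simp only [PathAlg.coef_of]
  by_cases h : p ∈ Set.range (pathB B A)
  · obtain ⟨⟨i, j, l, hl⟩, rfl⟩ := h
    obtain rfl : i = j := hp.2
    obtain rfl := hB.eq_nil_of_isPath hl
    rw [resB_of_pathB, Finset.sum_eq_single i]
    · rw [if_pos (by rfl), one_smul]; rfl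
    · intro j _ hj
      rw [if_neg, zero_smul]
      exact fun e => hj (congrArg FinQuiver.Path.source e).symm
    · simp
  · rw [resB_of_notMem h, Finset.sum_eq_zero]
    intro i _
    rw [if_neg, zero_smul]
    rintro rfl
    exact h ⟨FinQuiver.Path.vertex B.toFinQuiver i, rfl⟩

theorem val_projB_of_val (hB : B.IsDirected) {f : PathAlg k (dualExt B A).toFinQuiver}
    (hf : f ∈ PathAlg.spanOf k (dualExt B A).cyclicBasic)
    {z : (dualExt B A).Arr × (dualExt B A).Path →₀ k}
    (hz : ∀ c, (dualExt B A).val k c z = (dualExt B A).trunc k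
      (PathAlg.of k (FinQuiver.Path.arrow (dualExt B A).toFinQuiver c) * f -
        f * PathAlg.of k (FinQuiver.Path.arrow (dualExt B A).toFinQuiver c))) (b : B.Arr) :
    B.val k b (projB k B A z) =
      (PathAlg.coef k (FinQuiver.Path.vertex (dualExt B A).toFinQuiver (B.src b)) f -
        PathAlg.coef k (FinQuiver.Path.vertex (dualExt B A).toFinQuiver (B.tgt b)) f) •
          PathAlg.of k (FinQuiver.Path.arrow B.toFinQuiver b) := by
  rw [val_projB, hz, resB_trunc, map_sub, resB_mul, resB_mul, resB_arrow, resB_cyclic hB hf,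
    PathAlg.arrow_commutator_vertices (fun i => PathAlg.coef k
      (FinQuiver.Path.vertex (dualExt B A).toFinQuiver i) f), map_smul, trunc_of,
    if_pos (isBasic_arrow b)]

/-- The projection sends b to a multiple of b, which has degree one, and degree at least two forces
the multiple to be zero. -/
theorem projB_eq_zero_of_mem_idealI (hB : B.IsDirected)
    {z : (dualExt B A).Arr × (dualExt B A).Path →₀ k} (hz : z ∈ idealI k B A) :
    projB k B A z = 0 := by
  obtain ⟨f, hf, h⟩ := mem_imDelta0_iff.1 hz.1
  have hdeg : projB k B A z ∈
      Finsupp.supported k k {ap : B.Arr × B.Path | 2 ≤ ap.2.arrows.length} := by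
    rw [Finsupp.mem_supported']
    rintro ⟨b, q⟩ hq
    rw [projB_apply]
    refine (Finsupp.mem_supported' _ _).1 hz.2 _ fun h' => hq ?_
    have h2 : 2 ≤ (q.arrows.map (arrB B A)).length := h'
    rwa [List.length_map] at h2
  refine val_ext fun b => ?_
  have h1 := mem_supported_iff_val.1 hdeg b
  have h2 := val_projB_of_val hB hf h b
  have h3 := PathAlg.coef_eq_zero (p := FinQuiver.Path.arrow B.toFinQuiver b)
    (by simp [FinQuiver.Path.arrow]) h1
  rw [h2, map_smul, PathAlg.coef_of, if_pos rfl, smul_eq_mul, mul_one] at h3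
  rw [h2, h3, zero_smul, map_zero]

theorem idealI_le_idealJ (hA : A.IsDirected) (hB : B.IsDirected) :
    idealI k B A ≤ idealJ k B A := fun _ hz =>
  (mem_idealJ_iff hA hB (imDelta0_le_kerDelta1 hz.1)).2 (projB_eq_zero_of_mem_idealI hB hz)

/-- The vertex coefficients of f agree at the ends of each arrow of B, hence on components of Q_B,
hence at the ends of each arrow of A. The degree-one part then vanishes on all arrows of Λ. -/
theorem mem_idealI_of_projB_eq_zero (hB : B.IsDirected)
    (hconn : ∀ a : A.Arr, B.Linked (A.src a) (A.tgt a))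
    {z : (dualExt B A).Arr × (dualExt B A).Path →₀ k} (hz : z ∈ (dualExt B A).imDelta0 k)
    (h0 : projB k B A z = 0) : z ∈ idealI k B A := by
  refine ⟨hz, ?_⟩
  obtain ⟨f, hf, h⟩ := mem_imDelta0_iff.1 hz
  set c : Fin n → k := fun i =>
    PathAlg.coef k (FinQuiver.Path.vertex (dualExt B A).toFinQuiver i) f with hc
  have hcB : ∀ b : B.Arr, c (B.src b) = c (B.tgt b) := by
    intro b
    have h1 := congrArg (PathAlg.coef k (FinQuiver.Path.arrow B.toFinQuiver b))
      (val_projB_of_val hB hf h b)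
    rw [h0, map_zero, map_zero, map_smul, PathAlg.coef_of, if_pos rfl, smul_eq_mul,
      mul_one] at h1
    exact sub_eq_zero.1 h1.symm
  have hcΛ : ∀ d, c ((dualExt B A).src d) = c ((dualExt B A).tgt d) := by
    intro d
    rcases arr_cases d with ⟨b, rfl⟩ | ⟨a, rfl⟩
    · exact hcB b
    · exact (FinQuiver.eq_of_linked c hcB (hconn a)).symm
  change z ∈ Finsupp.supported k k _
  rw [mem_supported_iff_val]
  intro d
  rw [h d]
  refine trunc_mem_spanOf ?_
  -- The vertex part of f commutes with d, so f may be replaced by its part of positive length.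
  have h2 := PathAlg.arrow_commutator_mem (PathAlg.sub_degZero_mem f) d
  have h3 := PathAlg.arrow_commutator_vertices c d
  rw [hcΛ d, sub_self, zero_smul] at h3
  rw [mul_sub, sub_mul, sub_sub_sub_comm, PathAlg.degZero, h3, sub_zero] at h2
  exact h2

/-- A trivial path parallel to an arrow would make it a loop, and Λ has none. -/
theorem one_le_degree (hA : A.IsDirected) (hB : B.IsDirected)
    {x : (dualExt B A).Arr × (dualExt B A).Path →₀ k} (hx : x ∈ (dualExt B A).C1 k) :
    x ∈ Finsupp.supported k k
      {ap : (dualExt B A).Arr × (dualExt B A).Path | 1 ≤ ap.2.arrows.length} := by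
  refine Finsupp.supported_mono ?_ hx
  rintro ⟨c, ⟨i, j, l, hl⟩⟩ ⟨_, h1, h2⟩
  simp only at h1 h2
  subst h1 h2
  cases l with
  | nil => exact absurd hl (src_ne_tgt hA hB c)
  | cons a l => simp

/-- Stability holds under all of Ker δ¹_Λ: its elements have degree at least one, so bracketing with
them does not bring the degree below two. -/
theorem lie_mem_idealI (hA : A.IsDirected) (hB : B.IsDirected)
    (x : (dualExt B A).kerDelta1 k) {z : (dualExt B A).kerDelta1 k}
    (hz : z.1 ∈ idealI k B A) : (⁅x, z⁆ : (dualExt B A).kerDelta1 k).1 ∈ idealI k B A :=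
  ⟨lie_mem_imDelta0 x hz.1, br_mem_degree (one_le_degree hA hB x.2.1) hz.2⟩

/-! ### The image of `δ⁰` under the projection -/

theorem projB_mem_imDelta0 {z : (dualExt B A).Arr × (dualExt B A).Path →₀ k}
    (hz : z ∈ (dualExt B A).imDelta0 k) : projB k B A z ∈ B.imDelta0 k := by
  obtain ⟨f, hf, h⟩ := mem_imDelta0_iff.1 hz
  refine mem_imDelta0_iff.2 ⟨resB k B A f, ?_, fun b => ?_⟩
  · refine PathAlg.spanOf_induction (P := fun f => resB k B A f ∈ PathAlg.spanOf k B.cyclicBasic)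
      (by simp) (fun x y hx hy => by rw [map_add]; exact Submodule.add_mem _ hx hy)
      (fun c x hx => by rw [map_smul]; exact Submodule.smul_mem _ _ hx) (fun p hp => ?_) hf
    by_cases h : p ∈ Set.range (pathB B A)
    · obtain ⟨q, rfl⟩ := h
      rw [resB_of_pathB]
      exact PathAlg.of_mem_spanOf ⟨isBasic_pathB.1 hp.1, hp.2⟩
    · rw [resB_of_notMem h]
      exact Submodule.zero_mem _
  · rw [val_projB, h, resB_trunc, map_sub, resB_mul, resB_mul, resB_arrow]

/-- The combination of cycles f of B, read in kQ_Λ, defines an element of Im δ⁰_Λ whose projection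
is the given one. -/
theorem exists_projB_eq {y : B.Arr × B.Path →₀ k} (hy : y ∈ B.imDelta0 k) :
    ∃ z ∈ (dualExt B A).imDelta0 k, projB k B A z = y := by
  obtain ⟨f, hf, h⟩ := mem_imDelta0_iff.1 hy
  have hF : inclB k B A f ∈ PathAlg.spanOf k (dualExt B A).cyclicBasic := by
    refine PathAlg.spanOf_induction
      (P := fun f => inclB k B A f ∈ PathAlg.spanOf k (dualExt B A).cyclicBasic)
      (by simp) (fun x y hx hy => by rw [map_add]; exact Submodule.add_mem _ hx hy)
      (fun c x hx => by rw [map_smul]; exact Submodule.smul_mem _ _ hx) (fun p hp => ?_) hf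
    rw [inclB_of]
    exact PathAlg.of_mem_spanOf ⟨isBasic_pathB.2 hp.1, hp.2⟩
  refine ⟨∑ c, (dualExt B A).pair k c ((dualExt B A).trunc k
    (PathAlg.of k (FinQuiver.Path.arrow (dualExt B A).toFinQuiver c) * inclB k B A f -
      inclB k B A f * PathAlg.of k (FinQuiver.Path.arrow (dualExt B A).toFinQuiver c))),
    mem_imDelta0_iff.2 ⟨_, hF, fun c => val_sum_pair _ c⟩, val_ext fun b => ?_⟩
  rw [val_projB, val_sum_pair, resB_trunc, map_sub, resB_mul, resB_mul, resB_arrow, resB_inclB, h]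

end MonomialQuiver

/-- A morphism of Lie algebras factors through a surjective one with smaller kernel. -/
theorem LieHom.exists_factor {k L M N : Type*} [CommRing k] [LieRing L] [LieAlgebra k L]
    [LieRing M] [LieAlgebra k M] [LieRing N] [LieAlgebra k N] (p : L →ₗ⁅k⁆ M) (q : L →ₗ⁅k⁆ N)
    (hp : Function.Surjective p) (h : ∀ x, p x = 0 → q x = 0) :
    ∃ g : M →ₗ⁅k⁆ N, ∀ x, g (p x) = q x := by
  have inv : ∀ m, p (Function.surjInv hp m) = m := Function.surjInv_eq hp
  -- Two preimages under p differ by an element of its kernel, which q kills; so the chosen preimage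
  -- is irrelevant.
  have key : ∀ x, q (Function.surjInv hp (p x)) = q x := fun x => by
    rw [← sub_eq_zero, ← map_sub]
    exact h _ (by rw [map_sub, inv, sub_self])
  let g : M →ₗ⁅k⁆ N :=
    { toFun := fun m => q (Function.surjInv hp m)
      map_add' := fun m m' => by
        rw [← map_add, ← key (Function.surjInv hp m + _), map_add p, inv, inv]
      map_smul' := fun c m => by
        rw [RingHom.id_apply, ← map_smul, ← key (c • _), map_smul p, inv]
      map_lie' := fun {m m'} => by
        rw [← LieHom.map_lie, ← key ⁅_, _⁆, LieHom.map_lie p, inv, inv] }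
  exact ⟨g, key⟩

end

/-! ### The short exact sequence of Lie algebras. -/

noncomputable section

namespace MonomialQuiver

variable {n : ℕ} {k : Type*} [Field k] {B A : MonomialQuiver n}

theorem projKer_eq_zero_iff (hA : A.IsDirected) (hB : B.IsDirected)
    (x : (dualExt B A).kerDelta1 k) : projKer k hA hB x = 0 ↔ x.1 ∈ idealJ k B A := by
  rw [mem_idealJ_iff hA hB x.2]
  exact Subtype.ext_iff

variable (k) in
/-- `𝒥` as a Lie ideal. -/
def lieIdealJ (hA : A.IsDirected) (hB : B.IsDirected) :
    LieIdeal k ((dualExt B A).kerDelta1 k) := (projKer k hA hB).ker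

theorem mem_lieIdealJ (hA : A.IsDirected) (hB : B.IsDirected) (x : (dualExt B A).kerDelta1 k) :
    x ∈ lieIdealJ k hA hB ↔ x.1 ∈ idealJ k B A := by
  rw [← projKer_eq_zero_iff hA hB]
  exact LieHom.mem_ker

variable (k) in
/-- `ℐ` as a Lie ideal of `𝒥`. -/
def lieIdealI (hA : A.IsDirected) (hB : B.IsDirected) : LieIdeal k (lieIdealJ k hA hB) where
  carrier := {x | x.1.1 ∈ idealI k B A}
  add_mem' := fun hx hy => Submodule.add_mem (idealI k B A) hx hy
  zero_mem' := Submodule.zero_mem (idealI k B A)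
  smul_mem' := fun c _ hx => Submodule.smul_mem (idealI k B A) c hx
  lie_mem := fun {x _} hz => lie_mem_idealI hA hB x.1 hz

/-- The quotient map of a Lie algebra by a Lie ideal, as a morphism of Lie algebras. -/
def quotientHom {L : Type*} [LieRing L] [LieAlgebra k L] (I : LieIdeal k L) : L →ₗ⁅k⁆ (L ⧸ I) :=
  { (LieSubmodule.Quotient.mk' I : L →ₗ[k] (L ⧸ I)) with
    map_lie' := fun {x y} => LieSubmodule.Quotient.mk_bracket I x y }

theorem quotientHom_surjective {L : Type*} [LieRing L] [LieAlgebra k L] (I : LieIdeal k L) :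
    Function.Surjective (quotientHom I) := LieSubmodule.Quotient.surjective_mk' _

theorem quotientHom_eq_zero_iff {L : Type*} [LieRing L] [LieAlgebra k L] (I : LieIdeal k L)
    (x : L) : quotientHom I x = 0 ↔ x ∈ I := LieSubmodule.Quotient.mk_eq_zero I

theorem projKer_of_mem (hA : A.IsDirected) (hB : B.IsDirected) (x : lieIdealJ k hA hB) :
    projKer k hA hB x.1 = 0 := LieHom.mem_ker.1 x.2

variable (k) in
/-- The map `𝒥/ℐ → HH¹(Λ)` induced by the inclusion of `𝒥` in `Ker δ¹_Λ`. -/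
theorem exists_inclusion_hom (hA : A.IsDirected) (hB : B.IsDirected) :
    ∃ f : (lieIdealJ k hA hB ⧸ lieIdealI k hA hB) →ₗ⁅k⁆ HH1 k ((dualExt B A).Alg k),
      ∀ x, f (quotientHom _ x) = (dualExt B A).toHH1 k x.1 :=
  LieHom.exists_factor (quotientHom (lieIdealI k hA hB))
    (((dualExt B A).toHH1 k).comp (lieIdealJ k hA hB).incl) (quotientHom_surjective _)
    fun x hx => (toHH1_eq_zero_iff _).2 ((quotientHom_eq_zero_iff _ x).1 hx).1

variable (k) in
/-- The map `HH¹(Λ) → HH¹(B)` induced by the projection of `Ker δ¹_Λ` onto `Ker δ¹_B`. -/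
theorem exists_projection_hom (hA : A.IsDirected) (hB : B.IsDirected) :
    ∃ g : HH1 k ((dualExt B A).Alg k) →ₗ⁅k⁆ HH1 k (B.Alg k),
      ∀ x, g ((dualExt B A).toHH1 k x) = B.toHH1 k (projKer k hA hB x) :=
  LieHom.exists_factor ((dualExt B A).toHH1 k) ((B.toHH1 k).comp (projKer k hA hB))
    toHH1_surjective fun _ hx =>
      (toHH1_eq_zero_iff _).2 (projB_mem_imDelta0 ((toHH1_eq_zero_iff _).1 hx))

theorem injective_of_inclusion_hom (hA : A.IsDirected) (hB : B.IsDirected)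
    (hconn : ∀ a : A.Arr, B.Linked (A.src a) (A.tgt a))
    {f : (lieIdealJ k hA hB ⧸ lieIdealI k hA hB) →ₗ⁅k⁆ HH1 k ((dualExt B A).Alg k)}
    (hf : ∀ x, f (quotientHom _ x) = (dualExt B A).toHH1 k x.1) : Function.Injective f := by
  rw [injective_iff_map_eq_zero]
  intro u hu
  obtain ⟨x, rfl⟩ := quotientHom_surjective _ u
  rw [hf, toHH1_eq_zero_iff] at hu
  exact (quotientHom_eq_zero_iff _ x).2 (mem_idealI_of_projB_eq_zero hB hconn hu
    (congrArg Subtype.val (projKer_of_mem hA hB x)))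

theorem exact_of_inclusion_projection (hA : A.IsDirected) (hB : B.IsDirected)
    {f : (lieIdealJ k hA hB ⧸ lieIdealI k hA hB) →ₗ⁅k⁆ HH1 k ((dualExt B A).Alg k)}
    (hf : ∀ x, f (quotientHom _ x) = (dualExt B A).toHH1 k x.1)
    {g : HH1 k ((dualExt B A).Alg k) →ₗ⁅k⁆ HH1 k (B.Alg k)}
    (hg : ∀ x, g ((dualExt B A).toHH1 k x) = B.toHH1 k (projKer k hA hB x)) :
    Function.Exact f g := by
  intro u
  constructor
  · intro hu
    obtain ⟨x, rfl⟩ := toHH1_surjective u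
    rw [hg, toHH1_eq_zero_iff] at hu
    -- The projection of x is only known to lie in Im δ⁰_B. Subtracting a lift z from Im δ⁰_Λ puts x
    -- in 𝒥 without changing its class in HH¹(Λ).
    obtain ⟨z, hz, hzx⟩ := exists_projB_eq (A := A) hu
    let z' : (dualExt B A).kerDelta1 k := ⟨z, imDelta0_le_kerDelta1 hz⟩
    have hxz : projKer k hA hB (x - z') = 0 := by
      rw [map_sub, sub_eq_zero]
      exact Subtype.ext hzx.symm
    refine ⟨quotientHom _ ⟨x - z', LieHom.mem_ker.2 hxz⟩, ?_⟩
    rw [hf, map_sub, (toHH1_eq_zero_iff z').2 hz, sub_zero]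
  · rintro ⟨v, rfl⟩
    obtain ⟨x, rfl⟩ := quotientHom_surjective _ v
    rw [hf]
    exact (hg x.1).trans ((congrArg (B.toHH1 k) (projKer_of_mem hA hB x)).trans
      (map_zero (B.toHH1 k)))

theorem surjective_of_projection_hom (hA : A.IsDirected) (hB : B.IsDirected)
    {g : HH1 k ((dualExt B A).Alg k) →ₗ⁅k⁆ HH1 k (B.Alg k)}
    (hg : ∀ x, g ((dualExt B A).toHH1 k x) = B.toHH1 k (projKer k hA hB x)) :
    Function.Surjective g := by
  intro w
  obtain ⟨y, rfl⟩ := toHH1_surjective w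
  obtain ⟨x, rfl⟩ := projKer_surjective hA hB y
  exact ⟨_, hg x⟩

end MonomialQuiver

end

open MonomialQuiver in
theorem mainTheorem5 {k : Type*} [Field k] {n : ℕ} (A B : MonomialQuiver n)
    (hA : A.IsDirected) (hB : B.IsDirected)
    (hconn : ∀ a : A.Arr, B.Linked (A.src a) (A.tgt a)) :
    Disjoint (idealJ' k B A) (kerRel k B A) ∧
    idealI k B A ≤ idealJ k B A ∧
    ∃ (J : LieIdeal k ((dualExt B A).kerDelta1 k)) (I : LieIdeal k J),
      (∀ x : (dualExt B A).kerDelta1 k, x ∈ J ↔ x.1 ∈ idealJ k B A) ∧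
      (∀ x : J, x ∈ I ↔ x.1.1 ∈ idealI k B A) ∧
      ∃ (f : (J ⧸ I) →ₗ⁅k⁆ HH1 k ((dualExt B A).Alg k))
        (g : HH1 k ((dualExt B A).Alg k) →ₗ⁅k⁆ HH1 k (B.Alg k)),
        Function.Injective f ∧ Function.Exact f g ∧ Function.Surjective g ∧
        -- `f` is induced by the inclusion of `J` in `Ker δ¹`
        (∀ x : J, ∃ D : algDer k ((dualExt B A).Alg k), Represents k x.1.1 D ∧
          f (LieSubmodule.Quotient.mk x) = LieSubmodule.Quotient.mk D) ∧
        -- `g` is induced by the projection of `Ker δ¹_Λ` onto `Ker δ¹_B`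
        (∀ x : (dualExt B A).kerDelta1 k,
          projB k B A x.1 ∈ B.kerDelta1 k ∧
          ∃ (D : algDer k ((dualExt B A).Alg k)) (D' : algDer k (B.Alg k)),
            Represents k x.1 D ∧ Represents k (projB k B A x.1) D' ∧
            g (LieSubmodule.Quotient.mk D) = LieSubmodule.Quotient.mk D') := by
  refine ⟨disjoint_idealJ'_kerRel, idealI_le_idealJ hA hB, lieIdealJ k hA hB,
    lieIdealI k hA hB, mem_lieIdealJ hA hB, fun _ => Iff.rfl, ?_⟩
  obtain ⟨f, hf⟩ := exists_inclusion_hom k hA hB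
  obtain ⟨g, hg⟩ := exists_projection_hom k hA hB
  -- By definition `toHH1` is the class of `derOf`, so `hf` and `hg` are already statements about
  -- represented derivations.
  exact ⟨f, g, injective_of_inclusion_hom hA hB hconn hf,
    exact_of_inclusion_projection hA hB hf hg, surjective_of_projection_hom hA hB hg,
    fun x => ⟨(dualExt B A).derOf k x.1, represents_derOf x.1, hf x⟩,
    fun x => ⟨projB_mem_kerDelta1 hA hB x.2, (dualExt B A).derOf k x,
      B.derOf k (projKer k hA hB x), represents_derOf x, represents_derOf (projKer k hA hB x),
      hg x⟩⟩
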